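/- Let $n\ge 1$ be an integer, $0<s<1$ and $n\ge 2s$. Write $\mathbb{R}^n_+=\{x\in\mathbb{R}^n: x_n>0\}$, let $\mathcal{L}_{2s}$ be the space of $u\in L^1_{loc}(\mathbb{R}^n)$ with $\|u\|_{\mathcal{L}_{2s}}:=\int_{\mathbb{R}^n}\frac{|u(x)|}{1+|x|^{n+2s}}\,dx<\infty$, and let $$(-\Delta)^s u(x)=C_{n,s}\lim_{\varepsilon\to0^+}\int_{|x-y|\ge\varepsilon}\frac{u(x)-u(y)}{|x-y|^{n+2s}}\,dy,\qquad C_{n,s}=\frac{s\,4^s\,\Gamma(\frac n2+s)}{\pi^{n/2}\,\Gamma(1-s)} .$$ For all $R>0$ and $M_u,M_f,K\in\mathbb{R}$ there is a constant $C=C(n,s,R,M_u,M_f,K)$ such that the following holds. Let $u\in C^{1,1}_{loc}(\mathbb{R}^n_+)\cap\mathcal{L}_{2s}$ be a nonnegative solution of $$(-\Delta)^s u(x)=f(x)\ \text{ for } x\in\mathbb{R}^n_+,\qquad u(x)=0\ \text{ for } x\in\mathbb{R}^n\setminus\mathbb{R}^n_+,$$ with $\|u\|_{\mathcal{L}_{2s}}\le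 K$, and let $x_0\in\partial\mathbb{R}^n_+$ be a boundary point such that $|u|\le M_u$ and $|f|\le M_f$ in $B_R(x_0)\cap\mathbb{R}^n_+$. Then $$u(x)\le C\,x_n^s\quad\text{for all } x\in B_{R/2}(x_0)\cap\mathbb{R}^n_+,$$ and $u$ is $s$-Hölder continuous up to the boundary near $x_0$: $$|u(x)-u(y)|\le C|x-y|^s\quad\text{for all } x,y\in B_{R/2}(x_0)\cap\overline{\mathbb{R}^n_+}.$$ In particular, if $|u|\le M_u$ and $|f|\le M_f$ in the slab $\{0<x_n<R\}$, then $u(x)\le C x_n^s$ whenever $0<x_n<R/2$. -/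

import Mathlib

open MeasureTheory Filter Topology

noncomputable section

/-- The standard normalization constant
`C_{n,s} = s 4^s Γ(n/2 + s) / (π^{n/2} Γ(1 - s))` of the fractional Laplacian on `ℝⁿ`. -/
def fracLapConst (n : ℕ) (s : ℝ) : ℝ :=
  s * (4 : ℝ) ^ s * Real.Gamma ((n : ℝ) / 2 + s) /
    (Real.pi ^ ((n : ℝ) / 2) * Real.Gamma (1 - s))

/-- `(-Δ)^s u (x)` exists as a principal value and equals `L`:
`C_{n,s} ∫_{|x-y| ≥ ε} (u(x) - u(y)) / |x-y|^{n+2s} dy → L` as `ε → 0⁺`.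
For `u` in `L_{2s}` the truncated integrals converge absolutely. -/
def HasFracLaplacianAt {n : ℕ} (s : ℝ) (u : EuclideanSpace ℝ (Fin n) → ℝ)
    (x : EuclideanSpace ℝ (Fin n)) (L : ℝ) : Prop :=
  Tendsto
    (fun ε : ℝ => fracLapConst n s *
      ∫ y in (Metric.ball x ε)ᶜ, (u x - u y) / ‖x - y‖ ^ ((n : ℝ) + 2 * s))
    (𝓝[>] 0) (𝓝 L)

/-- The weighted space `L_{2s}`: locally integrable functions `u` on `ℝⁿ` with
`∫ |u(x)| / (1 + |x|^{n+2s}) dx < ∞`. -/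
def MemL2s {n : ℕ} (s : ℝ) (u : EuclideanSpace ℝ (Fin n) → ℝ) : Prop :=
  LocallyIntegrable u volume ∧
    Integrable (fun x => |u x| / (1 + ‖x‖ ^ ((n : ℝ) + 2 * s))) volume

/-- The norm `∫ |u(x)| / (1 + |x|^{n+2s}) dx` of `L_{2s}`. -/
def normL2s {n : ℕ} (s : ℝ) (u : EuclideanSpace ℝ (Fin n) → ℝ) : ℝ :=
  ∫ x, |u x| / (1 + ‖x‖ ^ ((n : ℝ) + 2 * s))

/-- `u ∈ C^{1,1}_loc(Ω)`: around every point of `Ω` there is a ball inside `Ω` on which `u` is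
differentiable with Lipschitz continuous derivative. -/
def IsC11Loc {n : ℕ} (u : EuclideanSpace ℝ (Fin n) → ℝ)
    (Ω : Set (EuclideanSpace ℝ (Fin n))) : Prop :=
  ∀ x ∈ Ω, ∃ r > 0, Metric.ball x r ⊆ Ω ∧ DifferentiableOn ℝ u (Metric.ball x r) ∧
    ∃ K : NNReal, LipschitzOnWith K (fderiv ℝ u) (Metric.ball x r)

/-- The open half space `ℝⁿ₊ = {x : x_n > 0}` in dimension `n = d + 1`; the coordinate `x_n` is
the last one. -/
def halfSpace (d : ℕ) : Set (EuclideanSpace ℝ (Fin (d + 1))) :=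
  {x | 0 < x (Fin.last d)}

/-- `u ∈ C^{1,1}_loc(ℝⁿ₊) ∩ L_{2s}` is a nonnegative solution of `(-Δ)^s u = f` in `ℝⁿ₊`,
`u = 0` in `ℝⁿ \ ℝⁿ₊`, where `n = d + 1`. -/
structure IsNonnegSolution {d : ℕ} (s : ℝ) (u f : EuclideanSpace ℝ (Fin (d + 1)) → ℝ) :
    Prop where
  memL2s : MemL2s s u
  c11 : IsC11Loc u (halfSpace d)
  nonneg : ∀ x, 0 ≤ u x
  eqn : ∀ x ∈ halfSpace d, HasFracLaplacianAt s u x (f x)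
  exterior : ∀ x ∉ halfSpace d, u x = 0

end

/-! Every estimate is a comparison at a touching point. The equation at `x` says that the principal
value of `u x - u (x + z)` against `|z|^{-n-2s}` equals `f x / C_{n,s}`. If this difference lies on
one side of an explicit function of `z`, the principal values are ordered in the same way
(`HasPV.mono`), and the second function can be integrated by hand.

Far mass (`exists_tail_bound`): a paraboloid touches `u` from below at a point well inside the half
space. At the contact point the distant values of the nonnegative function `u` enter the equation
with one sign, so their weighted integral is bounded by the local bounds of `u` and `f`.

Boundary growth (`exists_normal_growth`): `(x_n)₊^s` and `(x_n)₊^{s-1}` are `s`-harmonic in the half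
space (`hasPV_posPow`). Integrating out the tangential directions reduces this to one dimension,
where an inversion turns the integrand into an exact derivative. The barrier is `A (x_n)₊^s + ε
(x_n)₊^{s-1} + D |x - b|²`: the quadratic term localizes, the singular term keeps contact away from
the boundary and disappears as `ε → 0`, and the first term, although harmonic, has a positive far
part. Discarding that part gains a positive multiple of `A`, so a large `A` rules out contact.

Hölder bound (`exists_holder`): doubling of variables in the style of Ishii and Lions. At a positive
maximum of `u x - u y - L |x - y|^s - A |x - x₁|²` the increments at `x` and `y` are coupled by the
reflection in the hyperplane orthogonal to `x - y` when they are short compared with `|x - y|`, and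
taken equal otherwise. Concavity of `t^s` then yields a gain proportional to `L |x - y|^{-s}`, which
a large `L` makes impossible (`doubling_estimate`). The growth bound excludes maxima with `y` on or
beyond the boundary. -/

/-- The kernel `|z|^{-(n+2s)}` of the fractional Laplacian. -/
noncomputable def fracKernel {n : ℕ} (s : ℝ) (z : EuclideanSpace ℝ (Fin n)) : ℝ :=
  (‖z‖ ^ ((n : ℝ) + 2 * s))⁻¹

/-! ### Integrability of the kernel. -/

section Kernel

variable {n : ℕ} {s : ℝ}

lemma fracKernel_nonneg (z : EuclideanSpace ℝ (Fin n)) : 0 ≤ fracKernel s z := by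
  unfold fracKernel; positivity

lemma fracKernel_pos {z : EuclideanSpace ℝ (Fin n)} (hz : z ≠ 0) : 0 < fracKernel s z := by
  have := norm_pos_iff.2 hz
  unfold fracKernel; positivity

lemma fracKernel_neg (z : EuclideanSpace ℝ (Fin n)) : fracKernel s (-z) = fracKernel s z := by
  simp [fracKernel]

lemma fracKernel_isometry (σ : EuclideanSpace ℝ (Fin n) ≃ₗᵢ[ℝ] EuclideanSpace ℝ (Fin n))
    (z : EuclideanSpace ℝ (Fin n)) : fracKernel s (σ z) = fracKernel s z := by
  simp [fracKernel]

lemma measurable_fracKernel : Measurable (fracKernel (n := n) s) := by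
  unfold fracKernel; fun_prop

lemma integrableOn_fracKernel (hs : 0 < s) {r : ℝ} (hr : 0 < r) :
    IntegrableOn (fracKernel (n := n) s) (Metric.ball 0 r)ᶜ := by
  have h1 : Integrable (fun z : EuclideanSpace ℝ (Fin n) =>
      (1 + r⁻¹) ^ ((n : ℝ) + 2 * s) * (1 + ‖z‖) ^ (-((n : ℝ) + 2 * s))) :=
    (integrable_one_add_norm (by simp [hs])).const_mul _
  refine h1.integrableOn.mono' measurable_fracKernel.aestronglyMeasurable ?_
  filter_upwards [ae_restrict_mem Metric.isOpen_ball.measurableSet.compl] with z hz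
  have hz : r ≤ ‖z‖ := by simpa using hz
  have hzp : 0 < ‖z‖ := hr.trans_le hz
  rw [Real.norm_of_nonneg (fracKernel_nonneg z), fracKernel, Real.rpow_neg (by positivity),
    ← div_eq_mul_inv, ← Real.div_rpow (by positivity) (by positivity),
    ← Real.inv_rpow (by positivity)]
  apply Real.rpow_le_rpow (by positivity) _ (by positivity)
  rw [inv_le_iff_one_le_mul₀ hzp, div_mul_eq_mul_div, one_le_div (by positivity), add_mul, one_mul,
    add_comm]
  gcongr
  rw [inv_mul_eq_div]
  exact (one_le_div hr).2 hz

/-- In polar coordinates the radial density is `t^{1-2s}`, integrable at the origin since `s < 1`.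
-/
lemma integrableOn_sq_mul_fracKernel {d : ℕ} (hs : s < 1) (r : ℝ) :
    IntegrableOn (fun z : EuclideanSpace ℝ (Fin (d + 1)) => ‖z‖ ^ 2 * fracKernel s z)
      (Metric.ball 0 r) := by
  unfold fracKernel
  rw [integrableOn_fun_norm_addHaar volume
    (f := fun t => t ^ 2 * (t ^ (((d + 1 : ℕ) : ℝ) + 2 * s))⁻¹)]
  rcases le_or_gt r 0 with hr | hr
  · simp [Set.Ioo_eq_empty_of_le hr]
  have h := (intervalIntegral.integrableOn_Ioo_rpow_iff (s := 1 - 2 * s) hr).2 (by linarith)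
  refine h.congr_fun (fun t ht => ?_) measurableSet_Ioo
  have ht0 : 0 < t := ht.1
  simp only [finrank_euclideanSpace, Fintype.card_fin, Nat.add_sub_cancel, smul_eq_mul]
  rw [← Real.rpow_neg ht0.le, ← Real.rpow_natCast, ← Real.rpow_natCast, ← Real.rpow_add ht0,
    ← Real.rpow_add ht0]
  congr 1
  push_cast
  ring

end Kernel

/-! ### Calculus of principal values. -/

/-- The truncated integrals `∫_{|z| ≥ ε} q(z) |z|^{-n-2s} dz` converge absolutely and tend to `J`
as `ε → 0⁺`. -/
structure HasPV {n : ℕ} (s : ℝ) (q : EuclideanSpace ℝ (Fin n) → ℝ) (J : ℝ) : Prop where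
  integrableOn : ∀ ε > 0, IntegrableOn (fun z => q z * fracKernel s z) (Metric.ball 0 ε)ᶜ
  tendsto : Tendsto (fun ε => ∫ z in (Metric.ball 0 ε)ᶜ, q z * fracKernel s z) (𝓝[>] 0) (𝓝 J)

namespace HasPV

variable {n : ℕ} {s : ℝ} {p q : EuclideanSpace ℝ (Fin n) → ℝ} {I J : ℝ}

lemma add (hp : HasPV s p I) (hq : HasPV s q J) : HasPV s (fun z => p z + q z) (I + J) := by
  refine ⟨fun ε hε => ?_, ?_⟩
  · simp only [add_mul]
    exact (hp.integrableOn ε hε).add (hq.integrableOn ε hε)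
  · refine (hp.tendsto.add hq.tendsto).congr' ?_
    filter_upwards [self_mem_nhdsWithin] with ε hε
    simp only [add_mul]
    exact (integral_add (hp.integrableOn ε hε) (hq.integrableOn ε hε)).symm

lemma const_mul (c : ℝ) (hp : HasPV s p I) : HasPV s (fun z => c * p z) (c * I) := by
  refine ⟨fun ε hε => ?_, ?_⟩
  · simp only [mul_assoc]
    exact Integrable.const_mul (hp.integrableOn ε hε) c
  · refine (hp.tendsto.const_mul c).congr fun ε => ?_
    simp only [mul_assoc]
    exact (integral_const_mul _ _).symm

lemma sub (hp : HasPV s p I) (hq : HasPV s q J) : HasPV s (fun z => p z - q z) (I - J) := by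
  convert hp.add (hq.const_mul (-1)) using 2 <;> ring

/-- Only truncated integrals are compared, so touching arguments need no second-order expansion of
the solution at the contact point. -/
lemma mono (hp : HasPV s p I) (hq : HasPV s q J) (h : ∀ z, p z ≤ q z) : I ≤ J := by
  refine le_of_tendsto_of_tendsto hp.tendsto hq.tendsto ?_
  filter_upwards [self_mem_nhdsWithin] with ε hε
  exact integral_mono (hp.integrableOn ε hε) (hq.integrableOn ε hε)
    fun z => mul_le_mul_of_nonneg_right (h z) (fracKernel_nonneg z)

lemma of_integrable (h : Integrable fun z => q z * fracKernel s z) (hn : n ≠ 0) :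
    HasPV s q (∫ z, q z * fracKernel s z) := by
  have : NeZero n := ⟨hn⟩
  refine ⟨fun ε _ => h.integrableOn, ?_⟩
  have key : Tendsto (fun ε : ℝ => ∫ z, (Metric.ball (0 : EuclideanSpace ℝ (Fin n)) ε)ᶜ.indicator
      (fun z => q z * fracKernel s z) z) (𝓝[>] 0) (𝓝 (∫ z, q z * fracKernel s z)) := by
    refine tendsto_integral_filter_of_dominated_convergence (fun z => ‖q z * fracKernel s z‖)
      ?_ ?_ h.norm ?_
    · exact Eventually.of_forall fun ε =>
        h.aestronglyMeasurable.indicator Metric.isOpen_ball.measurableSet.compl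
    · exact Eventually.of_forall fun ε => ae_of_all _ fun z => norm_indicator_le_norm_self _ _
    · have h0 : ∀ᵐ z : EuclideanSpace ℝ (Fin n), z ≠ 0 := by
        simp [ae_iff]
      filter_upwards [h0] with z hz
      refine tendsto_const_nhds.congr' ?_
      have hlt : ∀ᶠ ε : ℝ in 𝓝[>] 0, ε < ‖z‖ :=
        nhdsWithin_le_nhds (eventually_lt_nhds (norm_pos_iff.2 hz))
      filter_upwards [hlt] with ε hε
      rw [Set.indicator_of_mem]
      simpa using hε.le
  refine key.congr fun ε => ?_
  rw [integral_indicator Metric.isOpen_ball.measurableSet.compl]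

/-- The kernel and the truncation regions are invariant under linear isometries. This permits the
mirror coupling in the Hölder estimate. -/
lemma comp_isometry (hp : HasPV s p I)
    (σ : EuclideanSpace ℝ (Fin n) ≃ₗᵢ[ℝ] EuclideanSpace ℝ (Fin n)) :
    HasPV s (fun z => p (σ z)) I := by
  have hmp := σ.measurePreserving
  have hemb : MeasurableEmbedding σ := σ.toHomeomorph.measurableEmbedding
  have hpre : ∀ ε : ℝ, σ ⁻¹' (Metric.ball 0 ε)ᶜ = (Metric.ball 0 ε)ᶜ := fun ε => by
    ext z; simp
  refine ⟨fun ε hε => ?_, ?_⟩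
  · have := (hmp.integrableOn_comp_preimage hemb).2 (hp.integrableOn ε hε)
    rw [hpre] at this
    simpa only [Function.comp_def, fracKernel_isometry] using this
  · refine hp.tendsto.congr fun ε => ?_
    have := hmp.setIntegral_preimage_emb hemb (fun z => p z * fracKernel s z) (Metric.ball 0 ε)ᶜ
    rw [hpre] at this
    simpa only [fracKernel_isometry] using this.symm

/-- Odd integrands have principal value zero. -/
lemma of_odd (hint : ∀ ε > 0, IntegrableOn (fun z => q z * fracKernel s z) (Metric.ball 0 ε)ᶜ)
    (hodd : ∀ z, q (-z) = -q z) : HasPV s q 0 := by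
  refine ⟨hint, tendsto_const_nhds.congr fun ε => ?_⟩
  have hmp := (LinearIsometryEquiv.neg ℝ (E := EuclideanSpace ℝ (Fin n))).measurePreserving
  have hemb := (LinearIsometryEquiv.neg ℝ
    (E := EuclideanSpace ℝ (Fin n))).toHomeomorph.measurableEmbedding
  have := hmp.setIntegral_preimage_emb hemb (fun z => q z * fracKernel s z) (Metric.ball 0 ε)ᶜ
  have hpre : (LinearIsometryEquiv.neg ℝ (E := EuclideanSpace ℝ (Fin n))) ⁻¹'
      (Metric.ball 0 ε)ᶜ = (Metric.ball 0 ε)ᶜ := by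
    ext z; simp
  rw [hpre] at this
  simp only [LinearIsometryEquiv.coe_neg, fracKernel_neg, hodd, neg_mul, integral_neg] at this
  linarith

/-- The principal value is computed by symmetrization. -/
lemma of_symm (hn : n ≠ 0)
    (hint : ∀ ε > 0, IntegrableOn (fun z => q z * fracKernel s z) (Metric.ball 0 ε)ᶜ)
    (hsymm : Integrable fun z => (q z + q (-z)) * fracKernel s z) :
    HasPV s q ((1 / 2) * ∫ z, (q z + q (-z)) * fracKernel s z) := by
  have h1 := (of_integrable hsymm hn).const_mul (1 / 2)
  -- The odd part of `q` contributes nothing, and the even part is absolutely integrable.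
  have h2 : HasPV s (fun z => q z - 1 / 2 * (q z + q (-z))) 0 := by
    refine of_odd (fun ε hε => ?_) fun z => by rw [neg_neg]; ring
    simp only [sub_mul]
    exact (hint ε hε).sub (h1.integrableOn ε hε)
  convert h1.add h2 using 2 <;> ring

lemma of_integrableOn_compl (hn : n ≠ 0) {r : ℝ}
    (hint : IntegrableOn (fun z => p z * fracKernel s z) (Metric.ball 0 r)ᶜ) :
    HasPV s ((Metric.ball 0 r)ᶜ.indicator p)
      (∫ z in (Metric.ball 0 r)ᶜ, p z * fracKernel s z) := by
  have he : (fun z => (Metric.ball 0 r)ᶜ.indicator p z * fracKernel s z) =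
      (Metric.ball 0 r)ᶜ.indicator fun z => p z * fracKernel s z := by
    ext z
    rw [Set.indicator_mul_left]
  have h := of_integrable (q := (Metric.ball 0 r)ᶜ.indicator p) (s := s) (by
    rw [he, integrable_indicator_iff Metric.isOpen_ball.measurableSet.compl]
    exact hint) hn
  rwa [he, integral_indicator Metric.isOpen_ball.measurableSet.compl] at h

lemma indicator_ball (hp : HasPV s p I) (hn : n ≠ 0) {r : ℝ} (hr : 0 < r) :
    HasPV s ((Metric.ball 0 r).indicator p)
      (I - ∫ z in (Metric.ball 0 r)ᶜ, p z * fracKernel s z) := by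
  convert hp.sub (of_integrableOn_compl hn (hp.integrableOn r hr)) using 2 with z
  by_cases hz : z ∈ Metric.ball 0 r <;> simp [hz]

end HasPV

/-- A linear function cut off near the origin has principal value zero. -/
lemma hasPV_linear {d : ℕ} {s : ℝ} (hs0 : 0 < s) {r : ℝ} (v : EuclideanSpace ℝ (Fin (d + 1))) :
    HasPV s ((Metric.ball (0 : EuclideanSpace ℝ (Fin (d + 1))) r).indicator
      fun z => 2 * inner ℝ z v) 0 := by
  have hm : MeasurableSet (Metric.ball (0 : EuclideanSpace ℝ (Fin (d + 1))) r) :=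
    Metric.isOpen_ball.measurableSet
  refine HasPV.of_odd (fun ε hε => ?_) fun z => ?_
  · have hK := Integrable.const_mul (integrableOn_fracKernel (n := d + 1) hs0 hε) (2 * |r| * ‖v‖)
    refine hK.mono' ?_ (ae_of_all _ fun z => ?_)
    · refine (Measurable.mul ?_ measurable_fracKernel).aestronglyMeasurable
      exact Measurable.indicator (by fun_prop) hm
    · rw [norm_mul, Real.norm_of_nonneg (fracKernel_nonneg z)]
      refine mul_le_mul_of_nonneg_right ?_ (fracKernel_nonneg z)
      by_cases hz : z ∈ Metric.ball 0 r
      · rw [Set.indicator_of_mem hz, norm_mul, mul_assoc]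
        have hz' : ‖z‖ ≤ |r| := (mem_ball_zero_iff.1 hz).le.trans (le_abs_self r)
        have := norm_inner_le_norm (𝕜 := ℝ) z v
        simp only [Real.norm_ofNat]
        have := mul_le_mul_of_nonneg_right hz' (norm_nonneg v)
        linarith
      · rw [Set.indicator_of_notMem hz, norm_zero]; positivity
  · by_cases hz : z ∈ Metric.ball 0 r
    · rw [Set.indicator_of_mem hz, Set.indicator_of_mem (by simpa using hz), inner_neg_left]
      ring
    · rw [Set.indicator_of_notMem hz, Set.indicator_of_notMem (by simpa using hz), neg_zero]

lemma HasPV.of_integrableOn_ball {n : ℕ} {s : ℝ} {p : EuclideanSpace ℝ (Fin n) → ℝ} (hn : n ≠ 0)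
    {r : ℝ} (hint : IntegrableOn (fun z => p z * fracKernel s z) (Metric.ball 0 r)) :
    HasPV s ((Metric.ball 0 r).indicator p) (∫ z in Metric.ball 0 r, p z * fracKernel s z) := by
  have he : (fun z => (Metric.ball 0 r).indicator p z * fracKernel s z) =
      (Metric.ball 0 r).indicator fun z => p z * fracKernel s z := by
    ext z
    rw [Set.indicator_mul_left]
  have h := HasPV.of_integrable (q := (Metric.ball 0 r).indicator p) (s := s) (by
    rw [he, integrable_indicator_iff Metric.isOpen_ball.measurableSet]
    exact hint) hn
  rwa [he, integral_indicator Metric.isOpen_ball.measurableSet] at h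

/-- The principal value of a quadratic polynomial without constant term, cut off near the
origin. -/
lemma hasPV_quadratic {d : ℕ} {s : ℝ} (hs0 : 0 < s) (hs1 : s < 1) {r : ℝ}
    (v : EuclideanSpace ℝ (Fin (d + 1))) :
    HasPV s ((Metric.ball 0 r).indicator fun z => 2 * inner ℝ z v + ‖z‖ ^ 2)
      (∫ z in Metric.ball (0 : EuclideanSpace ℝ (Fin (d + 1))) r, ‖z‖ ^ 2 * fracKernel s z) := by
  convert (hasPV_linear (r := r) hs0 v).add (HasPV.of_integrableOn_ball d.succ_ne_zero
    (integrableOn_sq_mul_fracKernel (d := d) hs1 r)) using 1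
  · ext z
    by_cases hz : z ∈ Metric.ball 0 r <;> simp [hz]
  · ring

/-! ### The powers `y₊^s` and `y₊^{s-1}` in one dimension. -/

/-- The power `y₊^p`, extended by zero to `y ≤ 0`. -/
noncomputable def posPow (p y : ℝ) : ℝ := if 0 < y then y ^ p else 0

section PosPow

variable {p s : ℝ}

lemma posPow_of_pos {y : ℝ} (hy : 0 < y) : posPow p y = y ^ p := if_pos hy

lemma posPow_of_nonpos {y : ℝ} (hy : y ≤ 0) : posPow p y = 0 := if_neg hy.not_gt

lemma posPow_nonneg (y : ℝ) : 0 ≤ posPow p y := by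
  unfold posPow; split_ifs with h
  · positivity
  · rfl

lemma measurable_posPow : Measurable (posPow p) :=
  Measurable.ite measurableSet_Ioi (by fun_prop) measurable_const

lemma posPow_mul {x : ℝ} (hx : 0 < x) (y : ℝ) : posPow p (x * y) = x ^ p * posPow p y := by
  rcases le_or_gt y 0 with hy | hy
  · rw [posPow_of_nonpos hy, posPow_of_nonpos (mul_nonpos_of_nonneg_of_nonpos hx.le hy), mul_zero]
  · rw [posPow_of_pos hy, posPow_of_pos (mul_pos hx hy), Real.mul_rpow hx.le hy.le]

end PosPow

lemma exists_rpow_lipschitz (r : ℝ) : ∃ C : ℝ, 0 ≤ C ∧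
    ∀ x ∈ Set.Icc (1 / 2 : ℝ) 2, ∀ y ∈ Set.Icc (1 / 2 : ℝ) 2, |x ^ r - y ^ r| ≤ C * |x - y| := by
  have hc : ContinuousOn (fun x : ℝ => r * x ^ (r - 1)) (Set.Icc (1 / 2 : ℝ) 2) := by
    refine continuousOn_const.mul (ContinuousOn.rpow_const continuousOn_id fun x hx => Or.inl ?_)
    have : (1 / 2 : ℝ) ≤ x := hx.1
    change x ≠ 0
    positivity
  obtain ⟨C, hC⟩ := isCompact_Icc.exists_bound_of_continuousOn hc
  refine ⟨C, (norm_nonneg _).trans (hC 1 (by norm_num)), fun x hx y hy => ?_⟩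
  refine (convex_Icc (1 / 2 : ℝ) 2).norm_image_sub_le_of_norm_hasDerivWithin_le
    (f := fun x : ℝ => x ^ r) (fun z hz => ?_) hC hy hx
  have : (1 / 2 : ℝ) ≤ z := hz.1
  exact (Real.hasDerivAt_rpow_const (Or.inl (by positivity))).hasDerivWithinAt

/-- With `α = (1+t)^{p/2}` and `β = (1-t)^{p/2}`, one has `2 - α² - β² = 2(1 - αβ) - (α - β)²` and
`αβ = (1-t²)^{p/2}`. Lipschitz bounds for the power `p/2` make both terms quadratic in `t`. -/
lemma exists_second_difference_rpow_le (p : ℝ) : ∃ C : ℝ,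
    ∀ t ∈ Set.Ioc (0 : ℝ) (1 / 2), |2 - (1 + t) ^ p - (1 - t) ^ p| ≤ C * t ^ 2 := by
  obtain ⟨C, hC0, hC⟩ := exists_rpow_lipschitz (p / 2)
  refine ⟨4 * C ^ 2 + 2 * C, fun t ⟨h0, h1⟩ => ?_⟩
  have e1 : (1 + t) ^ p = ((1 + t) ^ (p / 2)) ^ 2 := by
    rw [← Real.rpow_natCast, ← Real.rpow_mul (by linarith)]; norm_num
  have e2 : (1 - t) ^ p = ((1 - t) ^ (p / 2)) ^ 2 := by
    rw [← Real.rpow_natCast, ← Real.rpow_mul (by linarith)]; norm_num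
  have e3 : (1 + t) ^ (p / 2) * (1 - t) ^ (p / 2) = (1 - t ^ 2) ^ (p / 2) := by
    rw [← Real.mul_rpow (by linarith) (by linarith)]; ring_nf
  have h2 := hC (1 + t) ⟨by linarith, by linarith⟩ (1 - t) ⟨by linarith, by linarith⟩
  have h3 := hC 1 ⟨by norm_num, by norm_num⟩ (1 - t ^ 2) ⟨by nlinarith, by nlinarith⟩
  rw [show 1 + t - (1 - t) = 2 * t by ring, abs_of_pos (by linarith : 0 < 2 * t)] at h2
  rw [show 1 - (1 - t ^ 2) = t ^ 2 by ring, abs_of_nonneg (sq_nonneg t), Real.one_rpow, ← e3] at h3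
  rw [e1, e2]
  set α := (1 + t) ^ (p / 2)
  set β := (1 - t) ^ (p / 2)
  have h4 : (α - β) ^ 2 ≤ (C * (2 * t)) ^ 2 := sq_le_sq.2 (h2.trans (le_abs_self _))
  obtain ⟨h5, h6⟩ := abs_le.1 h3
  rw [abs_le]
  constructor <;> nlinarith [sq_nonneg (α - β)]

section HalfLine

variable {p s : ℝ}

/-- Three places matter: at `0` the second difference is quadratic and `s < 1`; at `t = 1` the
singularity `(1-t)^p` is integrable as `p > -1`; at infinity the growth exponent `p ≤ s` loses to
the decay `1 + 2s`. -/
lemma integrableOn_second_difference_posPow (hs0 : 0 < s) (hs1 : s < 1) (hp0 : -1 < p)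
    (hps : p ≤ s) :
    IntegrableOn (fun t => (2 - posPow p (1 + t) - posPow p (1 - t)) * t ^ (-1 - 2 * s))
      (Set.Ioi 0) := by
  have hmeas : Measurable
      (fun t => (2 - posPow p (1 + t) - posPow p (1 - t)) * t ^ (-1 - 2 * s)) := by
    have := measurable_posPow (p := p)
    fun_prop
  rw [← Set.Ioc_union_Ioi_eq_Ioi (by norm_num : (0 : ℝ) ≤ 1 / 2)]
  refine IntegrableOn.union ?_ ?_
  · obtain ⟨C, hC⟩ := exists_second_difference_rpow_le p
    have h := (intervalIntegral.intervalIntegrable_rpow' (a := 0) (b := 1 / 2)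
      (r := 1 - 2 * s) (by linarith)).const_mul C
    rw [intervalIntegrable_iff_integrableOn_Ioc_of_le (by norm_num)] at h
    refine h.mono' hmeas.aestronglyMeasurable ?_
    filter_upwards [ae_restrict_mem measurableSet_Ioc] with t ht
    have ht0 : 0 < t := ht.1
    have ht1 : t ≤ 1 / 2 := ht.2
    rw [norm_mul, Real.norm_of_nonneg (by positivity : 0 ≤ t ^ (-1 - 2 * s)), Real.norm_eq_abs,
      posPow_of_pos (by linarith), posPow_of_pos (by linarith)]
    refine (mul_le_mul_of_nonneg_right (hC t ht) (by positivity)).trans_eq ?_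
    rw [mul_assoc, ← Real.rpow_natCast, ← Real.rpow_add ht0]
    congr 2
    push_cast; ring
  · have hw : IntegrableOn (fun t : ℝ => t ^ (-1 - 2 * s)) (Set.Ioi (1 / 2)) :=
      integrableOn_Ioi_rpow_of_lt (by linarith) (by norm_num)
    have h1 : IntegrableOn (fun t : ℝ => posPow p (1 + t) * t ^ (-1 - 2 * s))
        (Set.Ioi (1 / 2)) := by
      have h : IntegrableOn (fun t : ℝ => 3 ^ s * t ^ (-1 - s)) (Set.Ioi (1 / 2)) :=
        (integrableOn_Ioi_rpow_of_lt (by linarith) (by norm_num)).const_mul _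
      refine h.mono' ?_ ?_
      · have := measurable_posPow (p := p)
        exact Measurable.aestronglyMeasurable (by fun_prop)
      filter_upwards [ae_restrict_mem measurableSet_Ioi] with t ht
      have ht : 1 / 2 < t := ht
      have ht0 : 0 < t := by linarith
      rw [posPow_of_pos (by linarith), Real.norm_of_nonneg (by positivity)]
      have h2 : (1 + t) ^ p ≤ (3 * t) ^ s :=
        (Real.rpow_le_rpow_of_exponent_le (by linarith) hps).trans
          (Real.rpow_le_rpow (by linarith) (by linarith) hs0.le)
      refine (mul_le_mul_of_nonneg_right h2 (by positivity)).trans_eq ?_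
      rw [Real.mul_rpow (by norm_num) ht0.le, mul_assoc, ← Real.rpow_add ht0]
      ring_nf
    have h2 : IntegrableOn (fun t : ℝ => posPow p (1 - t) * t ^ (-1 - 2 * s))
        (Set.Ioi (1 / 2)) := by
      have h0 : IntervalIntegrable (fun t : ℝ => (1 - t) ^ p) volume (1 - 0) (1 - 1) :=
        (intervalIntegral.intervalIntegrable_rpow' (a := 0) (b := 1) hp0).comp_sub_left 1
      have h0' : IntegrableOn (fun t : ℝ => (1 - t) ^ p) (Set.Ioc 0 1) := by
        have := h0.symm
        rw [sub_self, sub_zero, intervalIntegrable_iff_integrableOn_Ioc_of_le zero_le_one] at this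
        exact this
      have h : IntegrableOn ((Set.Ioc (0 : ℝ) 1).indicator
          fun t : ℝ => (1 / 2) ^ (-1 - 2 * s) * (1 - t) ^ p) (Set.Ioi (1 / 2)) :=
        ((integrable_indicator_iff measurableSet_Ioc).2 (h0'.const_mul _)).integrableOn
      refine h.mono' ?_ ?_
      · have := measurable_posPow (p := p)
        exact Measurable.aestronglyMeasurable (by fun_prop)
      filter_upwards [ae_restrict_mem measurableSet_Ioi] with t ht
      have ht : 1 / 2 < t := ht
      have ht0 : 0 < t := by linarith
      rcases lt_or_ge t 1 with h1 | h1
      · have hmem : t ∈ Set.Ioc (0 : ℝ) 1 := ⟨ht0, h1.le⟩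
        rw [Set.indicator_of_mem hmem,
          posPow_of_pos (by linarith),
          Real.norm_of_nonneg (mul_nonneg (Real.rpow_nonneg (by linarith) _) (by positivity)),
          mul_comm]
        refine mul_le_mul_of_nonneg_right ?_ (Real.rpow_nonneg (by linarith) _)
        exact Real.rpow_le_rpow_of_nonpos (by norm_num) ht.le (by linarith)
      · rw [posPow_of_nonpos (by linarith), zero_mul, norm_zero]
        refine Set.indicator_nonneg (fun t ht => ?_) t
        exact mul_nonneg (by positivity) (Real.rpow_nonneg (by linarith [ht.2]) _)
    have := ((hw.const_mul 2).sub h1).sub h2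
    refine IntegrableOn.congr_fun this (fun t _ => ?_) measurableSet_Ioi
    simp only [Pi.sub_apply]
    ring

/-- The inversion `1 + t = 1 / z`. -/
lemma integral_Ioi_inversion {ε : ℝ} (hε : 0 < ε) :
    ∫ t in Set.Ioi ε, (1 - (1 + t) ^ p) * t ^ (-1 - 2 * s) =
      ∫ z in Set.Ioo 0 (1 + ε)⁻¹,
        (z ^ (2 * s - 1) - z ^ (2 * s - 1 - p)) * (1 - z) ^ (-1 - 2 * s) := by
  have himg : (fun z : ℝ => z⁻¹ - 1) '' Set.Ioo 0 (1 + ε)⁻¹ = Set.Ioi ε := by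
    ext t
    constructor
    · rintro ⟨z, ⟨h0, h1⟩, rfl⟩
      have := (lt_inv_comm₀ h0 (by linarith)).1 h1
      simp only [Set.mem_Ioi]; linarith
    · intro ht
      have ht : ε < t := ht
      refine ⟨(1 + t)⁻¹, ⟨inv_pos.2 (by linarith), ?_⟩, by simp⟩
      exact inv_strictAnti₀ (by linarith) (by linarith)
  rw [← himg, integral_image_eq_integral_abs_deriv_smul measurableSet_Ioo
    (f' := fun z => -(z ^ 2)⁻¹)]
  · refine setIntegral_congr_fun measurableSet_Ioo fun z hz => ?_
    have h0 : 0 < z := hz.1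
    have h1 : z < 1 := hz.2.trans (inv_lt_one_of_one_lt₀ (by linarith))
    have e1 : z⁻¹ - 1 = (1 - z) * z⁻¹ := by field_simp
    have f (r : ℝ) : z⁻¹ ^ r = z ^ (-r) := by rw [Real.inv_rpow h0.le, Real.rpow_neg h0.le]
    simp only [smul_eq_mul, abs_neg]
    rw [abs_of_pos (by positivity : (0 : ℝ) < (z ^ 2)⁻¹), add_sub_cancel, e1,
      Real.mul_rpow (by linarith) (by positivity),
      f, f, ← Real.rpow_natCast, ← Real.rpow_neg h0.le]
    have e2 : z ^ (-((2 : ℕ) : ℝ)) * z ^ (-(-1 - 2 * s)) = z ^ (2 * s - 1) := by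
      rw [← Real.rpow_add h0]; congr 1; push_cast; ring
    have e3 : z ^ (2 * s - 1 - p) = z ^ (2 * s - 1) * z ^ (-p) := by
      rw [← Real.rpow_add h0, ← sub_eq_add_neg]
    rw [e3, ← e2]
    ring
  · intro z hz
    exact ((hasDerivAt_inv hz.1.ne').sub_const 1).hasDerivWithinAt
  · intro a _ b _ hab
    simpa using hab

lemma integrable_rpow_mul_one_sub_rpow {a b c : ℝ} (ha : -1 < a) (hc0 : 0 ≤ c) (hc : c < 1) :
    IntervalIntegrable (fun z : ℝ => z ^ a * (1 - z) ^ b) volume 0 c := by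
  refine (intervalIntegral.intervalIntegrable_rpow' ha).mul_continuousOn ?_
  refine ContinuousOn.rpow_const (by fun_prop) fun z hz => Or.inl ?_
  rw [Set.uIcc_of_le hc0] at hz
  linarith [hz.2]

/-- The primitive behind the `s`-harmonicity of `y₊^s` and `y₊^{s-1}`. -/
lemma integral_primitive (hs0 : 0 < s) {c : ℝ} (hc0 : 0 ≤ c) (hc : c < 1) :
    ∫ z in (0 : ℝ)..c, (1 - z ^ s + z ^ (2 * s - 1) - z ^ (s - 1)) * (1 - z) ^ (-1 - 2 * s) =
      (1 - c ^ s) ^ 2 * (1 - c) ^ (-2 * s) / (2 * s) - 1 / (2 * s) := by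
  -- The bracket factors as `(1 - z^s)(1 - z^{s-1})`, which makes the integrand an exact derivative.
  have h := intervalIntegral.integral_eq_sub_of_hasDerivAt_of_le hc0
    (f := fun z : ℝ => (1 - z ^ s) ^ 2 * (1 - z) ^ (-2 * s) / (2 * s))
    (f' := fun z => (1 - z ^ s + z ^ (2 * s - 1) - z ^ (s - 1)) * (1 - z) ^ (-1 - 2 * s))
    ?_ ?_ ?_
  · rw [h]
    simp [Real.zero_rpow hs0.ne']
  · refine ContinuousOn.div_const (ContinuousOn.mul ?_ ?_) _
    · exact ((continuousOn_const.sub (continuousOn_id.rpow_const fun _ _ => Or.inr hs0.le)).pow 2)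
    · refine ContinuousOn.rpow_const (by fun_prop) fun z hz => Or.inl ?_
      linarith [hz.2]
  · intro z hz
    have h0 : 0 < z := hz.1
    have h1 : 0 < 1 - z := by linarith [hz.2]
    have d1 : HasDerivAt (fun z : ℝ => 1 - z ^ s) (-(s * z ^ (s - 1))) z :=
      (Real.hasDerivAt_rpow_const (Or.inl h0.ne')).const_sub 1
    have d2 : HasDerivAt (fun z : ℝ => (1 - z) ^ (-2 * s))
        ((-1) * (-2 * s) * (1 - z) ^ (-2 * s - 1)) z :=
      ((hasDerivAt_id z).const_sub 1).rpow_const (Or.inl h1.ne')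
    refine (((d1.pow 2).mul d2).div_const (2 * s)).congr_deriv ?_
    have e1 : (1 - z) ^ (-2 * s) = (1 - z) ^ (-1 - 2 * s) * (1 - z) := by
      rw [← Real.rpow_add_one h1.ne']; ring_nf
    have e2 : (1 - z) ^ (-2 * s - 1) = (1 - z) ^ (-1 - 2 * s) := by ring_nf
    have e3 : z ^ (2 * s - 1) = z ^ s * z ^ (s - 1) := by
      rw [← Real.rpow_add h0]; ring_nf
    have e4 : z ^ s = z ^ (s - 1) * z := by
      rw [← Real.rpow_add_one h0.ne']; ring_nf
    rw [e1, e2, e3, e4]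
    simp only [Pi.pow_apply]
    rw [e4]
    field_simp
    push_cast
    ring
  · have i1 := integrable_rpow_mul_one_sub_rpow (a := 0) (b := -1 - 2 * s) (by linarith) hc0 hc
    have i2 := integrable_rpow_mul_one_sub_rpow (a := s) (b := -1 - 2 * s) (by linarith) hc0 hc
    have i3 := integrable_rpow_mul_one_sub_rpow (a := 2 * s - 1) (b := -1 - 2 * s)
      (by linarith) hc0 hc
    have i4 := integrable_rpow_mul_one_sub_rpow (a := s - 1) (b := -1 - 2 * s)
      (by linarith) hc0 hc
    refine (((i1.sub i2).add i3).sub i4).congr (fun z _ => ?_)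
    simp only [Real.rpow_zero]
    ring

/-- The functions `y₊^s` and `y₊^{s-1}` are `s`-harmonic at `y = 1`. -/
lemma integral_second_difference_posPow (hs0 : 0 < s) (hs1 : s < 1) (hp : p = s ∨ p = s - 1) :
    ∫ t in Set.Ioi 0, (2 - posPow p (1 + t) - posPow p (1 - t)) * t ^ (-1 - 2 * s) = 0 := by
  have hp0 : -1 < p := by rcases hp with rfl | rfl <;> linarith
  have hps : p ≤ s := by rcases hp with rfl | rfl <;> linarith
  have hq0 : -1 < 2 * s - 1 - p := by rcases hp with rfl | rfl <;> linarith
  -- The inversion replaces `p` by `2s - 1 - p`, which exchanges `s` and `s - 1`; both choices of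
  -- `p` therefore lead to the same primitive.
  have hsum (z : ℝ) : z ^ p + z ^ (2 * s - 1 - p) = z ^ s + z ^ (s - 1) := by
    rcases hp with rfl | rfl
    · ring_nf
    · ring_nf
  have hD := integrableOn_second_difference_posPow hs0 hs1 hp0 hps
  have hlim := (aecover_Ioi_of_Ioi (μ := volume) (A := (0 : ℝ)) (a := fun ε : ℝ => ε)
    (l := 𝓝[>] 0) (tendsto_id.mono_left nhdsWithin_le_nhds)).integral_tendsto_of_countably_generated
    hD
  obtain ⟨C₁, hC₁0, hC₁⟩ := exists_rpow_lipschitz s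
  obtain ⟨C₂, hC₂0, hC₂⟩ := exists_rpow_lipschitz (2 * s - 1)
  obtain ⟨C₃, hC₃0, hC₃⟩ := exists_rpow_lipschitz (2 * s - 1 - p)
  have hbound : ∀ ε ∈ Set.Ioo (0 : ℝ) (1 / 2),
      ‖∫ t in Set.Ioi ε, (2 - posPow p (1 + t) - posPow p (1 - t)) * t ^ (-1 - 2 * s)‖ ≤
        ((C₂ + C₃) * 2 ^ (2 * s) + C₁ ^ 2 / (2 * s)) * ε ^ (2 - 2 * s) := by
    rintro ε ⟨hε, hε2⟩
    have hw : IntegrableOn (fun t : ℝ => t ^ (-1 - 2 * s)) (Set.Ioi ε) :=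
      integrableOn_Ioi_rpow_of_lt (by linarith) hε
    have hDε := hD.mono_set (Set.Ioi_subset_Ioi hε.le)
    have hmeas := measurable_posPow (p := p)
    have hsumint : IntegrableOn (fun t => (posPow p (1 + t) + posPow p (1 - t)) *
        t ^ (-1 - 2 * s)) (Set.Ioi ε) := by
      refine IntegrableOn.congr_fun ((hw.const_mul 2).sub hDε) (fun t _ => ?_) measurableSet_Ioi
      simp only [Pi.sub_apply]
      ring
    -- Both powers are nonnegative, so integrability of their sum passes to each of them.
    have hA : IntegrableOn (fun t => posPow p (1 + t) * t ^ (-1 - 2 * s)) (Set.Ioi ε) := by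
      refine hsumint.mono' (Measurable.aestronglyMeasurable (by fun_prop)) ?_
      filter_upwards [ae_restrict_mem measurableSet_Ioi] with t ht
      have ht0 : 0 < t := hε.trans ht
      have h1 := posPow_nonneg (p := p) (1 + t)
      have h2 := posPow_nonneg (p := p) (1 - t)
      rw [Real.norm_of_nonneg (by positivity)]
      exact mul_le_mul_of_nonneg_right (by linarith) (by positivity)
    have hB : IntegrableOn (fun t => posPow p (1 - t) * t ^ (-1 - 2 * s)) (Set.Ioi ε) := by
      refine IntegrableOn.congr_fun (hsumint.sub hA) (fun t _ => ?_) measurableSet_Ioi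
      simp only [Pi.sub_apply]
      ring
    have hA' : IntegrableOn (fun t => (1 - posPow p (1 + t)) * t ^ (-1 - 2 * s)) (Set.Ioi ε) := by
      refine IntegrableOn.congr_fun (hw.sub hA) (fun t _ => ?_) measurableSet_Ioi
      simp only [Pi.sub_apply]
      ring
    have hB' : IntegrableOn (fun t => (1 - posPow p (1 - t)) * t ^ (-1 - 2 * s)) (Set.Ioi ε) := by
      refine IntegrableOn.congr_fun (hw.sub hB) (fun t _ => ?_) measurableSet_Ioi
      simp only [Pi.sub_apply]
      ring
    have hc1 : (1 + ε)⁻¹ < 1 := inv_lt_one_of_one_lt₀ (by linarith)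
    have hc0 : 0 < (1 + ε)⁻¹ := by positivity
    have hc2 : 1 - ε ≤ (1 + ε)⁻¹ := by
      rw [← one_div, le_div_iff₀ (by linarith)]; nlinarith
    have hc3 : (1 + ε)⁻¹ - (1 - ε) = ε ^ 2 * (1 + ε)⁻¹ := by field_simp; ring
    have hc4 : 1 - (1 + ε)⁻¹ = ε * (1 + ε)⁻¹ := by field_simp; ring
    have hc5 : (1 / 2 : ℝ) ≤ (1 + ε)⁻¹ := by
      rw [← one_div]; exact one_div_le_one_div_of_le (by linarith) (by linarith)
    set N₁ : ℝ → ℝ := fun z =>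
      (z ^ (2 * s - 1) - z ^ (2 * s - 1 - p)) * (1 - z) ^ (-1 - 2 * s) with hN₁
    set N₂ : ℝ → ℝ := fun z => (1 - z ^ p) * (1 - z) ^ (-1 - 2 * s) with hN₂
    have hN₁int : IntervalIntegrable N₁ volume 0 (1 + ε)⁻¹ := by
      refine ((integrable_rpow_mul_one_sub_rpow (a := 2 * s - 1) (b := -1 - 2 * s) (by linarith)
        hc0.le hc1).sub (integrable_rpow_mul_one_sub_rpow (b := -1 - 2 * s) hq0
        hc0.le hc1)).congr fun z _ => ?_
      simp only [hN₁]
      ring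
    have hN₂int : IntervalIntegrable N₂ volume 0 (1 - ε) := by
      refine ((integrable_rpow_mul_one_sub_rpow (a := 0) (b := -1 - 2 * s) (by linarith)
        (by linarith) (by linarith)).sub (integrable_rpow_mul_one_sub_rpow (b := -1 - 2 * s) hp0
        (by linarith) (by linarith))).congr fun z _ => ?_
      simp only [hN₂, Real.rpow_zero]
      ring
    have hS₁ : ∫ t in Set.Ioi ε, (1 - posPow p (1 + t)) * t ^ (-1 - 2 * s) =
        ∫ z in (0 : ℝ)..(1 + ε)⁻¹, N₁ z := by
      rw [intervalIntegral.integral_of_le hc0.le, integral_Ioc_eq_integral_Ioo,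
        ← integral_Ioi_inversion hε]
      refine setIntegral_congr_fun measurableSet_Ioi fun t ht => ?_
      have : ε < t := ht
      change (1 - posPow p (1 + t)) * _ = _
      rw [posPow_of_pos (by linarith)]
    have hS₂ : ∫ t in Set.Ioi ε, (1 - posPow p (1 - t)) * t ^ (-1 - 2 * s) =
        (∫ z in (0 : ℝ)..(1 - ε), N₂ z) + 1 / (2 * s) := by
      have hε1 : ε ≤ 1 := by linarith
      rw [← Set.Ioc_union_Ioi_eq_Ioi hε1, setIntegral_union Set.Ioc_disjoint_Ioi_same
        measurableSet_Ioi (hB'.mono_set Set.Ioc_subset_Ioi_self)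
        (hB'.mono_set (Set.Ioi_subset_Ioi hε1))]
      congr 1
      · rw [← intervalIntegral.integral_of_le hε1]
        have h := intervalIntegral.integral_comp_sub_left (a := ε) (b := 1)
          (fun z => (1 - posPow p z) * (1 - z) ^ (-1 - 2 * s)) 1
        simp only [sub_sub_cancel, sub_self] at h
        rw [h, intervalIntegral.integral_of_le (by linarith),
          intervalIntegral.integral_of_le (by linarith)]
        refine setIntegral_congr_fun measurableSet_Ioc fun z hz => ?_
        simp only [hN₂]
        rw [posPow_of_pos hz.1]
      · have h := integral_Ioi_rpow_of_lt (a := -1 - 2 * s) (by linarith) (zero_lt_one (α := ℝ))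
        rw [Real.one_rpow] at h
        rw [show -1 - 2 * s + 1 = -(2 * s) by ring, neg_div_neg_eq] at h
        rw [← h]
        refine setIntegral_congr_fun measurableSet_Ioi fun t ht => ?_
        have : 1 < t := ht
        change (1 - posPow p (1 - t)) * _ = _
        rw [posPow_of_nonpos (by linarith), sub_zero, one_mul]
    -- The two halves end at different points, `(1+ε)⁻¹` and `1 - ε`. The gap has length at most
    -- `ε²` and `N₁` is `O(ε^{-2s})` on it, so the mismatch is `O(ε^{2-2s})`.
    have hsplit : ∫ z in (0 : ℝ)..(1 + ε)⁻¹, N₁ z =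
        (∫ z in (0 : ℝ)..(1 - ε), N₁ z) + ∫ z in (1 - ε)..(1 + ε)⁻¹, N₁ z := by
      refine (intervalIntegral.integral_add_adjacent_intervals ?_ ?_).symm
      · exact hN₁int.mono_set (by
          rw [Set.uIcc_of_le (by linarith), Set.uIcc_of_le hc0.le]
          exact Set.Icc_subset_Icc_right hc2)
      · exact hN₁int.mono_set (by
          rw [Set.uIcc_of_le hc2, Set.uIcc_of_le hc0.le]
          exact Set.Icc_subset_Icc_left (by linarith))
    have hprim : (∫ z in (0 : ℝ)..(1 - ε), N₁ z) + (∫ z in (0 : ℝ)..(1 - ε), N₂ z) =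
        (1 - (1 - ε) ^ s) ^ 2 * ε ^ (-2 * s) / (2 * s) - 1 / (2 * s) := by
      have h := integral_primitive hs0 (c := 1 - ε) (by linarith) (by linarith)
      rw [sub_sub_cancel] at h
      rw [← h, ← intervalIntegral.integral_add (hN₁int.mono_set (by
          rw [Set.uIcc_of_le (by linarith), Set.uIcc_of_le hc0.le]
          exact Set.Icc_subset_Icc_right hc2)) hN₂int]
      refine intervalIntegral.integral_congr fun z _ => ?_
      simp only [hN₁, hN₂]
      rw [← add_mul]
      congr 1
      linarith [hsum z]
    -- The contribution `1/(2s)` of `t > 1`, where `posPow p (1 - t)` vanishes, cancels the value of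
    -- the primitive at `0`.
    have htotal : ∫ t in Set.Ioi ε, (2 - posPow p (1 + t) - posPow p (1 - t)) *
        t ^ (-1 - 2 * s) = (1 - (1 - ε) ^ s) ^ 2 * ε ^ (-2 * s) / (2 * s) +
          ∫ z in (1 - ε)..(1 + ε)⁻¹, N₁ z := by
      have h : ∫ t in Set.Ioi ε, (2 - posPow p (1 + t) - posPow p (1 - t)) * t ^ (-1 - 2 * s) =
          (∫ t in Set.Ioi ε, (1 - posPow p (1 + t)) * t ^ (-1 - 2 * s)) +
          ∫ t in Set.Ioi ε, (1 - posPow p (1 - t)) * t ^ (-1 - 2 * s) := by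
        rw [← integral_add hA' hB']
        congr 1 with t
        ring
      rw [h, hS₁, hS₂, hsplit]
      linarith
    have e1 : ε ^ (2 - 2 * s) = ε ^ 2 * ε ^ (-2 * s) := by
      rw [← Real.rpow_natCast, ← Real.rpow_add hε]; congr 1; push_cast; ring
    have hb1 : (1 - (1 - ε) ^ s) ^ 2 ≤ C₁ ^ 2 * ε ^ 2 := by
      have h := hC₁ 1 ⟨by norm_num, by norm_num⟩ (1 - ε) ⟨by linarith, by linarith⟩
      rw [Real.one_rpow, sub_sub_cancel, abs_of_pos hε] at h
      rw [← mul_pow]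
      exact sq_le_sq.2 (h.trans (le_abs_self _))
    have hb2 : ‖∫ z in (1 - ε)..(1 + ε)⁻¹, N₁ z‖ ≤
        ((C₂ + C₃) * (2 ^ (2 * s) * ε ^ (-2 * s))) * |(1 + ε)⁻¹ - (1 - ε)| := by
      refine intervalIntegral.norm_integral_le_of_norm_le_const fun z hz => ?_
      rw [Set.uIoc_of_le hc2] at hz
      have hz1 : 1 - ε < z := hz.1
      have hz2 : z ≤ (1 + ε)⁻¹ := hz.2
      have hzm : z ∈ Set.Icc (1 / 2 : ℝ) 2 := ⟨by linarith, by linarith⟩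
      have hpos : 0 < 1 - z := by linarith
      have h2 := hC₂ z hzm 1 ⟨by norm_num, by norm_num⟩
      have h3 := hC₃ z hzm 1 ⟨by norm_num, by norm_num⟩
      rw [Real.one_rpow, abs_sub_comm z 1, abs_of_pos hpos] at h2 h3
      have h4 : |z ^ (2 * s - 1) - z ^ (2 * s - 1 - p)| ≤ (C₂ + C₃) * (1 - z) := by
        have := abs_sub_le (z ^ (2 * s - 1)) 1 (z ^ (2 * s - 1 - p))
        rw [abs_sub_comm 1] at this
        linarith
      simp only [hN₁]
      rw [norm_mul, Real.norm_eq_abs, Real.norm_of_nonneg (by positivity)]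
      refine (mul_le_mul_of_nonneg_right h4 (by positivity)).trans ?_
      rw [mul_assoc]
      refine mul_le_mul_of_nonneg_left ?_ (by positivity)
      have e2 : (1 - z) * (1 - z) ^ (-1 - 2 * s) = (1 - z) ^ (-2 * s) := by
        rw [mul_comm, ← Real.rpow_add_one hpos.ne']; ring_nf
      have e3 : (2 : ℝ) ^ (2 * s) * ε ^ (-2 * s) = (ε / 2) ^ (-2 * s) := by
        rw [Real.div_rpow hε.le (by norm_num), div_eq_mul_inv, ← Real.rpow_neg (by norm_num)]
        ring_nf
      rw [e2, e3]
      refine Real.rpow_le_rpow_of_nonpos (by positivity) ?_ (by linarith)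
      nlinarith
    rw [htotal]
    refine (norm_add_le _ _).trans ?_
    have hb3 : |(1 + ε)⁻¹ - (1 - ε)| ≤ ε ^ 2 := by
      rw [hc3, abs_of_pos (by positivity)]
      nlinarith [sq_nonneg ε]
    have hb4 : ‖(1 - (1 - ε) ^ s) ^ 2 * ε ^ (-2 * s) / (2 * s)‖ ≤
        C₁ ^ 2 * ε ^ 2 * ε ^ (-2 * s) / (2 * s) := by
      rw [Real.norm_of_nonneg (by positivity)]
      gcongr
    have hb5 := mul_le_mul_of_nonneg_left hb3
      (by positivity : 0 ≤ (C₂ + C₃) * (2 ^ (2 * s) * ε ^ (-2 * s)))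
    rw [e1]
    have e4 : ((C₂ + C₃) * 2 ^ (2 * s) + C₁ ^ 2 / (2 * s)) * (ε ^ 2 * ε ^ (-2 * s)) =
        C₁ ^ 2 * ε ^ 2 * ε ^ (-2 * s) / (2 * s) +
          (C₂ + C₃) * (2 ^ (2 * s) * ε ^ (-2 * s)) * ε ^ 2 := by ring
    rw [e4]
    linarith
  have hzero : Tendsto (fun ε : ℝ => ((C₂ + C₃) * 2 ^ (2 * s) + C₁ ^ 2 / (2 * s)) *
      ε ^ (2 - 2 * s)) (𝓝[>] 0) (𝓝 0) := by
    have h : Tendsto (fun ε : ℝ => ε ^ (2 - 2 * s)) (𝓝[>] 0) (𝓝 0) := by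
      have := (Real.continuous_rpow_const (q := 2 - 2 * s) (by linarith)).tendsto 0
      rw [Real.zero_rpow (by linarith)] at this
      exact this.mono_left nhdsWithin_le_nhds
    simpa using h.const_mul ((C₂ + C₃) * 2 ^ (2 * s) + C₁ ^ 2 / (2 * s))
  have hlim0 : Tendsto (fun ε : ℝ => ∫ t in Set.Ioi ε,
      (2 - posPow p (1 + t) - posPow p (1 - t)) * t ^ (-1 - 2 * s)) (𝓝[>] 0) (𝓝 0) := by
    refine squeeze_zero_norm' ?_ hzero
    filter_upwards [Ioo_mem_nhdsGT (by norm_num : (0 : ℝ) < 1 / 2)] with ε hε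
    exact hbound ε hε
  refine tendsto_nhds_unique (hlim.congr' ?_) hlim0
  filter_upwards [self_mem_nhdsWithin] with ε hε
  have hε : 0 < ε := hε
  rw [Measure.restrict_restrict measurableSet_Ioi, Set.Ioi_inter_Ioi, max_eq_left hε.le]

end HalfLine

/-! ### Reduction to one dimension by integrating over hyperplanes. -/

section Marginal

variable {d : ℕ} {s : ℝ}

/-- Splitting off the last coordinate. -/
noncomputable def splitLast (d : ℕ) :
    EuclideanSpace ℝ (Fin (d + 1)) ≃ᵐ ℝ × EuclideanSpace ℝ (Fin d) :=
  ((MeasurableEquiv.toLp 2 (Fin (d + 1) → ℝ)).symm.trans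
    (MeasurableEquiv.piFinSuccAbove (fun _ => ℝ) (Fin.last d))).trans
    ((MeasurableEquiv.refl ℝ).prodCongr (MeasurableEquiv.toLp 2 (Fin d → ℝ)))

lemma measurePreserving_splitLast : MeasurePreserving (splitLast d) := by
  have h1 := PiLp.volume_preserving_ofLp (Fin (d + 1))
  have h2 := volume_preserving_piFinSuccAbove (fun _ : Fin (d + 1) => ℝ) (Fin.last d)
  have h3 := (MeasurePreserving.id (volume : Measure ℝ)).prod (PiLp.volume_preserving_toLp (Fin d))
  exact h3.comp (h2.comp h1)

lemma splitLast_fst (z : EuclideanSpace ℝ (Fin (d + 1))) : (splitLast d z).1 = z (Fin.last d) := rfl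

lemma norm_sq_splitLast (z : EuclideanSpace ℝ (Fin (d + 1))) :
    ‖z‖ ^ 2 = (splitLast d z).1 ^ 2 + ‖(splitLast d z).2‖ ^ 2 := by
  rw [EuclideanSpace.norm_sq_eq, EuclideanSpace.norm_sq_eq, Fin.sum_univ_succAbove _ (Fin.last d)]
  simp only [Real.norm_eq_abs, sq_abs]
  rfl

/-- The mass of the hyperplane sections of the kernel. -/
noncomputable def sectionConst (d : ℕ) (s : ℝ) : ℝ :=
  ∫ w : EuclideanSpace ℝ (Fin d), (1 + ‖w‖ ^ 2) ^ (-(((d + 1 : ℕ) : ℝ) + 2 * s) / 2)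

lemma fracKernel_eq_splitLast (z : EuclideanSpace ℝ (Fin (d + 1))) :
    fracKernel s z = ((splitLast d z).1 ^ 2 + ‖(splitLast d z).2‖ ^ 2) ^
      (-(((d + 1 : ℕ) : ℝ) + 2 * s) / 2) := by
  rw [← norm_sq_splitLast, fracKernel, ← Real.rpow_neg (norm_nonneg z), ← Real.rpow_natCast,
    ← Real.rpow_mul (norm_nonneg z)]
  congr 1
  push_cast; ring

lemma section_kernel_eq {t : ℝ} (ht : t ≠ 0) (w : EuclideanSpace ℝ (Fin d)) :
    (t ^ 2 + ‖w‖ ^ 2) ^ (-(((d + 1 : ℕ) : ℝ) + 2 * s) / 2) =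
      |t| ^ (-(((d + 1 : ℕ) : ℝ) + 2 * s)) *
        (1 + ‖|t|⁻¹ • w‖ ^ 2) ^ (-(((d + 1 : ℕ) : ℝ) + 2 * s) / 2) := by
  have h0 : 0 < |t| := abs_pos.2 ht
  have e1 : t ^ 2 + ‖w‖ ^ 2 = |t| ^ 2 * (1 + ‖|t|⁻¹ • w‖ ^ 2) := by
    rw [norm_smul, mul_pow, norm_inv, Real.norm_eq_abs, abs_abs, ← sq_abs t]
    field_simp
  rw [e1, Real.mul_rpow (by positivity) (by positivity), ← Real.rpow_natCast |t|,
    ← Real.rpow_mul h0.le]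
  congr 2
  push_cast; ring

lemma integrable_section (hs : 0 < s) {t : ℝ} (ht : t ≠ 0) :
    Integrable fun w : EuclideanSpace ℝ (Fin d) =>
      (t ^ 2 + ‖w‖ ^ 2) ^ (-(((d + 1 : ℕ) : ℝ) + 2 * s) / 2) := by
  have h0 : 0 < |t| := abs_pos.2 ht
  have h := integrable_rpow_neg_one_add_norm_sq (μ := (volume : Measure (EuclideanSpace ℝ (Fin d))))
    (r := ((d + 1 : ℕ) : ℝ) + 2 * s) (by simp; linarith)
  simp only [section_kernel_eq ht]
  exact (h.comp_smul (inv_ne_zero h0.ne')).const_mul _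

lemma integral_section {t : ℝ} (ht : t ≠ 0) :
    ∫ w : EuclideanSpace ℝ (Fin d), (t ^ 2 + ‖w‖ ^ 2) ^ (-(((d + 1 : ℕ) : ℝ) + 2 * s) / 2) =
      sectionConst d s * |t| ^ (-1 - 2 * s) := by
  have h0 : 0 < |t| := abs_pos.2 ht
  simp only [section_kernel_eq ht]
  rw [integral_const_mul, Measure.integral_comp_inv_smul_of_nonneg volume
    (fun w : EuclideanSpace ℝ (Fin d) => (1 + ‖w‖ ^ 2) ^ (-(((d + 1 : ℕ) : ℝ) + 2 * s) / 2)) h0.le,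
    smul_eq_mul, finrank_euclideanSpace, Fintype.card_fin, ← mul_assoc, ← Real.rpow_natCast,
    ← Real.rpow_add h0, mul_comm, sectionConst]
  congr 2
  push_cast; ring

/-- Fubini in the last coordinate: by scaling, the section of the kernel at height `t` has mass
`sectionConst d s * |t|^{-1-2s}`, the one-dimensional kernel. -/
lemma integrable_and_integral_last_mul_fracKernel (hs : 0 < s) {h : ℝ → ℝ} (hm : Measurable h)
    (hint : Integrable fun t => h t * |t| ^ (-1 - 2 * s)) :
    Integrable (fun z : EuclideanSpace ℝ (Fin (d + 1)) => h (z (Fin.last d)) * fracKernel s z) ∧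
    ∫ z : EuclideanSpace ℝ (Fin (d + 1)), h (z (Fin.last d)) * fracKernel s z =
      sectionConst d s * ∫ t, h t * |t| ^ (-1 - 2 * s) := by
  have hne : ∀ᵐ t : ℝ, t ≠ 0 := by simp [ae_iff]
  set F : ℝ × EuclideanSpace ℝ (Fin d) → ℝ := fun x =>
    h x.1 * (x.1 ^ 2 + ‖x.2‖ ^ 2) ^ (-(((d + 1 : ℕ) : ℝ) + 2 * s) / 2) with hF
  have hFm : Measurable F := by simp only [hF]; fun_prop
  have hcomp : (fun z : EuclideanSpace ℝ (Fin (d + 1)) => h (z (Fin.last d)) * fracKernel s z) =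
      F ∘ splitLast d := by
    ext z
    simp only [hF, Function.comp_apply, fracKernel_eq_splitLast, splitLast_fst]
  have hFint : Integrable F := by
    refine (integrable_prod_iff hFm.aestronglyMeasurable).2 ⟨?_, ?_⟩
    · filter_upwards [hne] with t ht
      exact (integrable_section (d := d) hs ht).const_mul (h t)
    · refine (hint.norm.const_mul (sectionConst d s)).congr ?_
      filter_upwards [hne] with t ht
      simp only [hF, norm_mul]
      rw [integral_const_mul, Real.norm_of_nonneg (by positivity : 0 ≤ |t| ^ (-1 - 2 * s)),
        mul_left_comm, ← integral_section ht]
      congr 2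
      ext w
      rw [Real.norm_of_nonneg (by positivity)]
  have hemb : MeasurableEmbedding (splitLast d) := (splitLast d).measurableEmbedding
  rw [hcomp]
  refine ⟨(measurePreserving_splitLast.integrable_comp_emb hemb).2 hFint, ?_⟩
  have h1 := measurePreserving_splitLast.integral_comp hemb F
  rw [Function.comp_def, h1, Measure.volume_eq_prod, integral_prod _ hFint, ← integral_const_mul]
  refine integral_congr_ae ?_
  filter_upwards [hne] with t ht
  simp only [hF]
  rw [integral_const_mul, integral_section ht]
  ring

end Marginal

/-! ### Harmonicity of the powers in the half space. -/

section Harmonic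

variable {d : ℕ} {p s : ℝ}

lemma integrable_of_even {f : ℝ → ℝ} (hf : ∀ t, f (-t) = f t) (h : IntegrableOn f (Set.Ioi 0)) :
    Integrable f := by
  have h1 : IntegrableOn (fun t => f (-t)) (Set.Iio 0) := by
    rw [← Measure.map_neg_eq_self (volume : Measure ℝ)]
    let m : MeasurableEmbedding fun x : ℝ => -x := (Homeomorph.neg ℝ).measurableEmbedding
    rw [m.integrableOn_map_iff]
    simpa [Function.comp_def] using h
  simp only [hf] at h1
  rw [← integrableOn_univ, ← Set.Iic_union_Ioi (a := (0 : ℝ))]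
  exact (h1.congr_set_ae (Iio_ae_eq_Iic (μ := volume) (a := (0 : ℝ))).symm).union h

lemma second_difference_posPow_scaled (hs0 : 0 < s) (hs1 : s < 1) (hp : p = s ∨ p = s - 1)
    {x : ℝ} (hx : 0 < x) :
    Integrable (fun t => (2 * posPow p x - posPow p (x + t) - posPow p (x - t)) *
      |t| ^ (-1 - 2 * s)) ∧
    ∫ t, (2 * posPow p x - posPow p (x + t) - posPow p (x - t)) * |t| ^ (-1 - 2 * s) = 0 := by
  have hp0 : -1 < p := by rcases hp with rfl | rfl <;> linarith
  have hps : p ≤ s := by rcases hp with rfl | rfl <;> linarith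
  set F : ℝ → ℝ := fun t => (2 - posPow p (1 + t) - posPow p (1 - t)) * |t| ^ (-1 - 2 * s) with hF
  have heven (t : ℝ) : F (-t) = F t := by
    simp only [hF, abs_neg, sub_neg_eq_add, ← sub_eq_add_neg]
    ring
  have hF0 : IntegrableOn F (Set.Ioi 0) := by
    refine (integrableOn_second_difference_posPow hs0 hs1 hp0 hps).congr_fun (fun t ht => ?_)
      measurableSet_Ioi
    have ht : 0 < t := ht
    simp only [hF, abs_of_pos ht]
  have hFint : Integrable F := integrable_of_even heven hF0
  have hFzero : ∫ t, F t = 0 := by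
    have habs (t : ℝ) : F |t| = F t := by
      rcases abs_cases t with ⟨h, _⟩ | ⟨h, _⟩ <;> rw [h]
      exact heven t
    have h := integral_comp_abs (f := F)
    simp only [habs] at h
    rw [h, mul_eq_zero]
    right
    refine Eq.trans ?_ (integral_second_difference_posPow hs0 hs1 hp)
    refine setIntegral_congr_fun measurableSet_Ioi fun t ht => ?_
    have ht : 0 < t := ht
    simp only [hF, abs_of_pos ht]
  have hscale : (fun t => (2 * posPow p x - posPow p (x + t) - posPow p (x - t)) *
      |t| ^ (-1 - 2 * s)) = fun t => (x ^ p * x ^ (-1 - 2 * s)) * F (x⁻¹ • t) := by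
    ext t
    have e1 : x + t = x * (1 + x⁻¹ * t) := by field_simp
    have e2 : x - t = x * (1 - x⁻¹ * t) := by field_simp
    have e3 : |t| = x * |x⁻¹ * t| := by
      rw [abs_mul, abs_of_pos (inv_pos.2 hx)]; field_simp
    rw [e1, e2, e3, posPow_mul hx, posPow_mul hx, posPow_of_pos hx,
      Real.mul_rpow hx.le (abs_nonneg _)]
    simp only [hF, smul_eq_mul]
    ring
  rw [hscale]
  refine ⟨(hFint.comp_smul (inv_ne_zero hx.ne')).const_mul _, ?_⟩
  rw [integral_const_mul, Measure.integral_comp_inv_smul_of_nonneg volume F hx.le, hFzero]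
  simp

/-- The functions `(x_n)₊^s` and `(x_n)₊^{s-1}` are `s`-harmonic in the half space. -/
lemma hasPV_posPow (hs0 : 0 < s) (hs1 : s < 1) (hp : p = s ∨ p = s - 1) {x : ℝ} (hx : 0 < x) :
    HasPV s (fun z : EuclideanSpace ℝ (Fin (d + 1)) =>
      posPow p x - posPow p (x + z (Fin.last d))) 0 := by
  have hmeas := measurable_posPow (p := p)
  obtain ⟨h1, h2⟩ := second_difference_posPow_scaled hs0 hs1 hp hx
  obtain ⟨h3, h4⟩ := integrable_and_integral_last_mul_fracKernel (d := d) hs0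
    (h := fun t => 2 * posPow p x - posPow p (x + t) - posPow p (x - t)) (by fun_prop) h1
  have he (z : EuclideanSpace ℝ (Fin (d + 1))) :
      posPow p x - posPow p (x + z (Fin.last d)) +
        (posPow p x - posPow p (x + (-z) (Fin.last d))) =
      2 * posPow p x - posPow p (x + z (Fin.last d)) - posPow p (x - z (Fin.last d)) := by
    rw [PiLp.neg_apply, ← sub_eq_add_neg]; ring
  have h := HasPV.of_symm (s := s) (q := fun z : EuclideanSpace ℝ (Fin (d + 1)) =>
      posPow p x - posPow p (x + z (Fin.last d))) d.succ_ne_zero ?_ (by simpa only [he] using h3)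
  · simpa only [he, h4, h2, mul_zero] using h
  · intro ε hε
    have hK := integrableOn_fracKernel (n := d + 1) hs0 hε
    have hlast : Measurable fun z : EuclideanSpace ℝ (Fin (d + 1)) => z (Fin.last d) := by fun_prop
    -- Dropping the nonnegative `posPow p (x - z_n)` bounds this by `2 * posPow p x` minus the
    -- integrable second difference.
    have hb : IntegrableOn (fun z : EuclideanSpace ℝ (Fin (d + 1)) =>
        posPow p (x + z (Fin.last d)) * fracKernel s z) (Metric.ball 0 ε)ᶜ := by
      refine Integrable.mono' ((Integrable.const_mul hK (2 * posPow p x)).sub h3.integrableOn)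
        ((hmeas.comp (by fun_prop)).mul measurable_fracKernel).aestronglyMeasurable
        (ae_of_all _ fun z => ?_)
      have h5 := mul_nonneg (posPow_nonneg (p := p) (x - z (Fin.last d)))
        (fracKernel_nonneg (s := s) z)
      rw [Real.norm_of_nonneg (mul_nonneg (posPow_nonneg _) (fracKernel_nonneg z))]
      simp only [Pi.sub_apply]
      linarith
    simp only [sub_mul]
    exact (Integrable.const_mul hK _).sub hb

end Harmonic

lemma fracLapConst_pos {n : ℕ} {s : ℝ} (hs0 : 0 < s) (hs1 : s < 1) : 0 < fracLapConst n s := by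
  have h1 := Real.Gamma_pos_of_pos (by positivity : 0 < (n : ℝ) / 2 + s)
  have h2 := Real.Gamma_pos_of_pos (by linarith : 0 < 1 - s)
  have := Real.pi_pos
  unfold fracLapConst
  positivity

/-! ### From the definition of the fractional Laplacian to principal values. -/

section Shift

variable {n : ℕ} {s : ℝ} {u : EuclideanSpace ℝ (Fin n) → ℝ}

/-- For `‖z‖ ≥ ε` the weight `1 + ‖x + z‖^{n+2s}` is at most a constant times `‖z‖^{n+2s}`. -/
lemma MemL2s.integrableOn_shift (hs : 0 < s) (hu : MemL2s s u) (x : EuclideanSpace ℝ (Fin n))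
    {ε : ℝ} (hε : 0 < ε) :
    IntegrableOn (fun z => u (x + z) * fracKernel s z) (Metric.ball 0 ε)ᶜ := by
  set m : ℝ := (n : ℝ) + 2 * s with hm
  have hm0 : 0 < m := by positivity
  have h1 : Integrable fun z => |u (x + z)| / (1 + ‖x + z‖ ^ m) :=
    hu.2.comp_add_left x
  have h2 := (h1.const_mul (ε⁻¹ ^ m + (1 + ‖x‖ * ε⁻¹) ^ m)).integrableOn
    (s := (Metric.ball (0 : EuclideanSpace ℝ (Fin n)) ε)ᶜ)
  have hmeas : AEStronglyMeasurable (fun z => u (x + z)) volume :=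
    hu.1.aestronglyMeasurable.comp_measurePreserving (measurePreserving_add_left volume x)
  refine h2.mono' (hmeas.mul measurable_fracKernel.aestronglyMeasurable).restrict ?_
  filter_upwards [ae_restrict_mem Metric.isOpen_ball.measurableSet.compl] with z hz
  have hz : ε ≤ ‖z‖ := by simpa using hz
  have hzp : 0 < ‖z‖ := hε.trans_le hz
  rw [norm_mul, Real.norm_eq_abs, Real.norm_of_nonneg (fracKernel_nonneg z), mul_div_left_comm]
  refine mul_le_mul_of_nonneg_left ?_ (abs_nonneg _)
  rw [fracKernel, ← hm, ← one_div, div_le_div_iff₀ (by positivity) (by positivity), one_mul, add_mul,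
    ← Real.mul_rpow (by positivity) hzp.le, ← Real.mul_rpow (by positivity) hzp.le]
  have h3 : 1 ≤ ε⁻¹ * ‖z‖ := by rw [inv_mul_eq_div]; exact (one_le_div hε).2 hz
  refine add_le_add (Real.one_le_rpow h3 hm0.le) ?_
  refine Real.rpow_le_rpow (norm_nonneg _) ?_ hm0.le
  have h4 := mul_le_mul_of_nonneg_left h3 (norm_nonneg x)
  nlinarith [norm_add_le x z]

lemma HasFracLaplacianAt.hasPV (hs0 : 0 < s) (hs1 : s < 1) (hu : MemL2s s u)
    {x : EuclideanSpace ℝ (Fin n)} {L : ℝ} (h : HasFracLaplacianAt s u x L) :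
    HasPV s (fun z => u x - u (x + z)) (L / fracLapConst n s) := by
  have hc := fracLapConst_pos (n := n) hs0 hs1
  refine ⟨fun ε hε => ?_, ?_⟩
  · simp only [sub_mul]
    exact (Integrable.const_mul (integrableOn_fracKernel hs0 hε) _).sub
      (hu.integrableOn_shift hs0 x hε)
  · have h' := Tendsto.div_const h (fracLapConst n s)
    refine h'.congr fun ε => ?_
    rw [mul_div_cancel_left₀ _ hc.ne']
    have hpre : (fun z => x + z) ⁻¹' (Metric.ball x ε)ᶜ = (Metric.ball 0 ε)ᶜ := by
      ext z; simp
    rw [← (measurePreserving_add_left volume x).setIntegral_preimage_emb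
      (measurableEmbedding_addLeft x), hpre]
    refine integral_congr_ae (ae_of_all _ fun z => ?_)
    simp [fracKernel, div_eq_mul_inv]

end Shift

section Regularity

variable {n : ℕ} {u : EuclideanSpace ℝ (Fin n) → ℝ} {Ω : Set (EuclideanSpace ℝ (Fin n))}

lemma IsC11Loc.continuousAt (hu : IsC11Loc u Ω) {x : EuclideanSpace ℝ (Fin n)} (hx : x ∈ Ω) :
    ContinuousAt u x := by
  obtain ⟨r, hr, _, hd, _⟩ := hu x hx
  exact hd.continuousOn.continuousAt (Metric.ball_mem_nhds x hr)

end Regularity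

lemma abs_last_le_norm {d : ℕ} (z : EuclideanSpace ℝ (Fin (d + 1))) : |z (Fin.last d)| ≤ ‖z‖ := by
  simpa using PiLp.norm_apply_le z (Fin.last d)

lemma norm_add_sub_sq {n : ℕ} (x z y : EuclideanSpace ℝ (Fin n)) :
    ‖x + z - y‖ ^ 2 = ‖x - y‖ ^ 2 + (2 * inner ℝ z (x - y) + ‖z‖ ^ 2) := by
  rw [show x + z - y = z + (x - y) by abel, norm_add_sq_real]
  ring

/-! ### Bound for the far-away mass. -/

section Tail

variable {d : ℕ} {s : ℝ} {u f : EuclideanSpace ℝ (Fin (d + 1)) → ℝ}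

lemma IsNonnegSolution.hasPV (hs0 : 0 < s) (hs1 : s < 1) (h : IsNonnegSolution s u f)
    {x : EuclideanSpace ℝ (Fin (d + 1))} (hx : x ∈ halfSpace d) :
    HasPV s (fun z => u x - u (x + z)) (f x / fracLapConst (d + 1) s) :=
  (h.eqn x hx).hasPV hs0 hs1 h.memL2s

/-- Far-away mass seen from one interior point, by touching with a paraboloid from below. -/
lemma exists_tail_bound_at_point (hs0 : 0 < s) (hs1 : s < 1) {R : ℝ} (hR : 0 < R) (M N : ℝ) :
    ∃ T, ∀ u f : EuclideanSpace ℝ (Fin (d + 1)) → ℝ, IsNonnegSolution s u f →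
      ∀ x₀ : EuclideanSpace ℝ (Fin (d + 1)), x₀ (Fin.last d) = 0 →
      (∀ x ∈ Metric.ball x₀ R, u x ≤ M) → (∀ x ∈ Metric.ball x₀ R ∩ halfSpace d, |f x| ≤ N) →
      ∃ y ∈ Metric.ball x₀ (7 * R / 8),
        ∫ z in (Metric.ball 0 (R / 8))ᶜ, u (y + z) * fracKernel s z ≤ T := by
  have hc := fracLapConst_pos (n := d + 1) hs0 hs1
  -- Chosen so that `A (R/8)² = M + 1` exceeds `u x₁`: the minimum point of `u + A |· - x₁|²` then
  -- lies within `R/8` of `x₁`.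
  set A : ℝ := 64 * (M + 1) / R ^ 2 with hA
  set c₂ := ∫ z in Metric.ball (0 : EuclideanSpace ℝ (Fin (d + 1))) (R / 8),
    ‖z‖ ^ 2 * fracKernel s z
  set c₃ := ∫ z in (Metric.ball (0 : EuclideanSpace ℝ (Fin (d + 1))) (R / 8))ᶜ, fracKernel s z
    with hc₃
  refine ⟨A * c₂ + M * c₃ + N / fracLapConst (d + 1) s, fun u f hsol x₀ hx₀ hM hN => ?_⟩
  have hR8 : 0 < R / 8 := by positivity
  have hM0 : 0 ≤ M := (hsol.nonneg x₀).trans (hM x₀ (Metric.mem_ball_self hR))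
  have hA0 : 0 ≤ A := by positivity
  set x₁ := x₀ + EuclideanSpace.single (Fin.last d) (R / 2) with hx₁
  have hx₁d : ‖x₁ - x₀‖ = R / 2 := by
    rw [hx₁, add_sub_cancel_left]
    simp [abs_of_pos hR]
  have hx₁l : x₁ (Fin.last d) = R / 2 := by simp [hx₁, hx₀]
  have hball : ∀ x ∈ Metric.closedBall x₁ (R / 4), x ∈ Metric.ball x₀ R ∩ halfSpace d := by
    intro x hx
    rw [mem_closedBall_iff_norm] at hx
    constructor
    · rw [mem_ball_iff_norm]
      have := norm_sub_le_norm_sub_add_norm_sub x x₁ x₀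
      linarith
    · have h1 := (abs_le.1 ((abs_last_le_norm (x - x₁)).trans hx)).1
      rw [PiLp.sub_apply, hx₁l] at h1
      change 0 < x (Fin.last d)
      linarith
  have hcont : ContinuousOn (fun x => u x + A * ‖x - x₁‖ ^ 2) (Metric.closedBall x₁ (R / 4)) := by
    refine ContinuousOn.add (fun x hx => ?_) (by fun_prop)
    exact (hsol.c11.continuousAt (hball x hx).2).continuousWithinAt
  have hx₁m : x₁ ∈ Metric.closedBall x₁ (R / 4) := Metric.mem_closedBall_self (by positivity)
  obtain ⟨y, hy, hmin⟩ := (isCompact_closedBall x₁ (R / 4)).exists_isMinOn ⟨x₁, hx₁m⟩ hcont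
  have hyx₁ : ‖y - x₁‖ < R / 8 := by
    have h1 : u y + A * ‖y - x₁‖ ^ 2 ≤ u x₁ + A * ‖x₁ - x₁‖ ^ 2 := hmin hx₁m
    rw [sub_self, norm_zero] at h1
    have h2 := hM x₁ (hball x₁ hx₁m).1
    have h3 := hsol.nonneg y
    by_contra! hcon
    have h4 : (R / 8) ^ 2 ≤ ‖y - x₁‖ ^ 2 := by gcongr
    have h5 := mul_le_mul_of_nonneg_left h4 hA0
    have h6 : A * (R / 8) ^ 2 = M + 1 := by rw [hA]; field_simp; norm_num
    nlinarith
  obtain ⟨hyb, hyh⟩ := hball y hy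
  refine ⟨y, ?_, ?_⟩
  · rw [mem_ball_iff_norm]
    have := norm_sub_le_norm_sub_add_norm_sub y x₁ x₀
    linarith
  have hP := hsol.hasPV hs0 hs1 hyh
  have hshift := hsol.memL2s.integrableOn_shift hs0 y hR8
  have hKM := Integrable.const_mul (integrableOn_fracKernel (n := d + 1) hs0 hR8) M
  have hQ := ((hasPV_quadratic (r := R / 8) hs0 hs1 (y - x₁)).const_mul A).add
    (HasPV.of_integrableOn_compl (p := fun z => M - u (y + z)) d.succ_ne_zero (by
      simp only [sub_mul]
      exact hKM.sub hshift))
  -- Touching bounds the difference by a quadratic polynomial near `y`; elsewhere `u y ≤ M` is used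
  -- and `-u (y + z)` is kept, which puts the tail on the favourable side.
  have hle := hP.mono hQ fun z => by
    by_cases hz : z ∈ Metric.ball 0 (R / 8)
    · rw [Set.indicator_of_mem hz, Set.indicator_of_notMem (by simpa using hz), add_zero]
      have hyz : y + z ∈ Metric.closedBall x₁ (R / 4) := by
        rw [mem_closedBall_iff_norm, show y + z - x₁ = (y - x₁) + z by abel]
        have := norm_add_le (y - x₁) z
        have := mem_ball_zero_iff.1 hz
        linarith
      have h1 : u y + A * ‖y - x₁‖ ^ 2 ≤ u (y + z) + A * ‖y + z - x₁‖ ^ 2 := hmin hyz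
      rw [norm_add_sub_sq] at h1
      linarith
    · rw [Set.indicator_of_notMem hz, Set.indicator_of_mem (by simpa using hz)]
      linarith [hM y hyb]
  simp only [sub_mul] at hle
  rw [integral_sub hKM hshift, integral_const_mul, ← hc₃] at hle
  have hf : -(N / fracLapConst (d + 1) s) ≤ f y / fracLapConst (d + 1) s := by
    rw [← neg_div]
    gcongr
    exact (abs_le.1 (hN y ⟨hyb, hyh⟩)).1
  linarith

/-- The far-away mass of `u` is controlled by the local bounds of `u` and `f`. -/
lemma exists_tail_bound (hs0 : 0 < s) (hs1 : s < 1) {R : ℝ} (hR : 0 < R) (M N : ℝ) {r : ℝ}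
    (hr : 0 < r) :
    ∃ T, 0 ≤ T ∧ ∀ u f : EuclideanSpace ℝ (Fin (d + 1)) → ℝ, IsNonnegSolution s u f →
      ∀ x₀ : EuclideanSpace ℝ (Fin (d + 1)), x₀ (Fin.last d) = 0 →
      (∀ x ∈ Metric.ball x₀ R, u x ≤ M) → (∀ x ∈ Metric.ball x₀ R ∩ halfSpace d, |f x| ≤ N) →
      ∀ x ∈ Metric.ball x₀ R, ∫ z in (Metric.ball 0 r)ᶜ, u (x + z) * fracKernel s z ≤ T := by
  obtain ⟨T₀, hT₀⟩ := exists_tail_bound_at_point (d := d) hs0 hs1 hR M N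
  set m : ℝ := ((d + 1 : ℕ) : ℝ) + 2 * s with hm
  have hm0 : 0 < m := by positivity
  -- For `‖z‖ ≥ r` and `‖x - y‖ ≤ 2R`, moving the centre from `x` to `y` enlarges `‖z‖` at most by
  -- this factor.
  set Λ : ℝ := 1 + 2 * R * r⁻¹ with hΛ
  have hΛ0 : 0 < Λ := by positivity
  set c₃ := ∫ z in (Metric.ball (0 : EuclideanSpace ℝ (Fin (d + 1))) r)ᶜ, fracKernel s z with hc₃
  refine ⟨max 0 (Λ ^ m * T₀ + M * c₃), le_max_left _ _,
    fun u f hsol x₀ hx₀ hM hN x hx => le_max_of_le_right ?_⟩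
  obtain ⟨y, hy, hyT⟩ := hT₀ u f hsol x₀ hx₀ hM hN
  have hM0 : 0 ≤ M := (hsol.nonneg x₀).trans (hM x₀ (Metric.mem_ball_self hR))
  rw [mem_ball_iff_norm] at hx hy
  have hmeas : MeasurableSet (Metric.ball (0 : EuclideanSpace ℝ (Fin (d + 1))) (R / 8))ᶜ :=
    Metric.isOpen_ball.measurableSet.compl
  set G : EuclideanSpace ℝ (Fin (d + 1)) → ℝ :=
    (Metric.ball 0 (R / 8))ᶜ.indicator fun z => u (y + z) * fracKernel s z with hG
  have hGint : Integrable G := (integrable_indicator_iff hmeas).2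
    (hsol.memL2s.integrableOn_shift hs0 y (by positivity))
  have hGnn (z) : 0 ≤ G z := Set.indicator_nonneg
    (fun z _ => mul_nonneg (hsol.nonneg _) (fracKernel_nonneg z)) z
  have hG' : Integrable fun z => G (z + (x - y)) := hGint.comp_add_right (x - y)
  have hGT : ∫ z, G (z + (x - y)) ≤ T₀ := by
    rw [integral_add_right_eq_self G, hG, integral_indicator hmeas]
    exact hyT
  have hKint := integrableOn_fracKernel (n := d + 1) hs0 hr
  have hpt : ∀ z ∈ (Metric.ball (0 : EuclideanSpace ℝ (Fin (d + 1))) r)ᶜ,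
      u (x + z) * fracKernel s z ≤ Λ ^ m * G (z + (x - y)) + M * fracKernel s z := by
    intro z hz
    have hz : r ≤ ‖z‖ := by simpa using hz
    have hzp : 0 < ‖z‖ := hr.trans_le hz
    have hxz : y + (z + (x - y)) = x + z := by abel
    -- Close to `y` the point is still in `B_R(x₀)`, where `u ≤ M`; farther away the kernels centred
    -- at `x` and `y` are comparable.
    by_cases hw : z + (x - y) ∈ Metric.ball 0 (R / 8)
    · have h1 : x + z ∈ Metric.ball x₀ R := by
        rw [mem_ball_iff_norm, ← hxz, show y + (z + (x - y)) - x₀ = (z + (x - y)) + (y - x₀) by abel]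
        have := norm_add_le (z + (x - y)) (y - x₀)
        have := mem_ball_zero_iff.1 hw
        linarith
      have h2 := mul_le_mul_of_nonneg_right (hM _ h1) (fracKernel_nonneg (s := s) z)
      have h3 := mul_nonneg (Real.rpow_nonneg hΛ0.le m) (hGnn (z + (x - y)))
      linarith
    · have hwn : R / 8 ≤ ‖z + (x - y)‖ := by simpa using hw
      have hwp : 0 < ‖z + (x - y)‖ := lt_of_lt_of_le (by positivity) hwn
      rw [hG, Set.indicator_of_mem (by simpa using hw), hxz]
      have h1 : ‖z + (x - y)‖ ≤ Λ * ‖z‖ := by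
        have h2 := norm_add_le z (x - y)
        have h3 := norm_sub_le (x - x₀) (y - x₀)
        rw [sub_sub_sub_cancel_right] at h3
        have h4 : 1 ≤ r⁻¹ * ‖z‖ := by rw [inv_mul_eq_div]; exact (one_le_div hr).2 hz
        have h5 := mul_le_mul_of_nonneg_left h4 (by positivity : 0 ≤ 2 * R)
        rw [hΛ]
        nlinarith
      have h2 : fracKernel s z ≤ Λ ^ m * fracKernel s (z + (x - y)) := by
        rw [fracKernel, fracKernel, ← hm, ← div_eq_mul_inv, ← one_div,
          div_le_div_iff₀ (by positivity) (by positivity), one_mul,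
          ← Real.mul_rpow hΛ0.le hzp.le]
        exact Real.rpow_le_rpow hwp.le h1 hm0.le
      have h3 := mul_le_mul_of_nonneg_left h2 (hsol.nonneg (x + z))
      have h4 := mul_nonneg hM0 (fracKernel_nonneg (s := s) z)
      linarith
  have hstep := setIntegral_mono_on (hsol.memL2s.integrableOn_shift hs0 x hr)
    (((hG'.const_mul (Λ ^ m)).integrableOn (s := (Metric.ball 0 r)ᶜ)).add
      (Integrable.const_mul hKint M)) Metric.isOpen_ball.measurableSet.compl hpt
  refine hstep.trans ?_
  rw [integral_add' (hG'.const_mul (Λ ^ m)).integrableOn (Integrable.const_mul hKint M),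
    integral_const_mul, integral_const_mul, ← hc₃]
  have h5 := setIntegral_le_integral (s := (Metric.ball 0 r)ᶜ) hG' (ae_of_all _ fun z => hGnn _)
  have h6 := mul_le_mul_of_nonneg_left (h5.trans hGT) (Real.rpow_nonneg hΛ0.le m)
  linarith

end Tail

/-! ### Barrier and boundary growth. -/

section Barrier

variable {d : ℕ} {s : ℝ}

lemma posPow_mono {p : ℝ} (hp : 0 ≤ p) {x y : ℝ} (h : x ≤ y) : posPow p x ≤ posPow p y := by
  rcases le_or_gt x 0 with hx | hx
  · rw [posPow_of_nonpos hx]; exact posPow_nonneg y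
  · rw [posPow_of_pos hx, posPow_of_pos (hx.trans_le h)]
    exact Real.rpow_le_rpow hx.le h hp

lemma integrableOn_posPow_last (hs0 : 0 < s) (hs1 : s < 1) {r : ℝ} (hr : 0 < r) :
    IntegrableOn (fun z : EuclideanSpace ℝ (Fin (d + 1)) =>
      posPow s (z (Fin.last d)) * fracKernel s z) (Metric.ball 0 r)ᶜ := by
  have h1 := (hasPV_posPow (d := d) hs0 hs1 (Or.inl rfl) zero_lt_one).integrableOn r hr
  have h2 := Integrable.sub (Integrable.const_mul (integrableOn_fracKernel (n := d + 1) hs0 hr)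
    (posPow s 1)) h1
  have hlast : Measurable fun z : EuclideanSpace ℝ (Fin (d + 1)) => z (Fin.last d) := by fun_prop
  refine h2.mono' ((measurable_posPow.comp hlast).mul measurable_fracKernel).aestronglyMeasurable
    (ae_of_all _ fun z => ?_)
  rw [Real.norm_of_nonneg (mul_nonneg (posPow_nonneg _) (fracKernel_nonneg z))]
  have h3 : posPow s (z (Fin.last d)) ≤ posPow s (1 + z (Fin.last d)) :=
    posPow_mono hs0.le (by linarith)
  have h4 := mul_le_mul_of_nonneg_right h3 (fracKernel_nonneg (s := s) z)
  simp only [Pi.sub_apply]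
  linarith

/-- This positive constant multiplies `A` in the barrier comparison, so it decides that a large `A`
wins. -/
lemma integral_posPow_last_pos (hs0 : 0 < s) (hs1 : s < 1) {r : ℝ} (hr : 0 < r) :
    0 < ∫ z in (Metric.ball (0 : EuclideanSpace ℝ (Fin (d + 1))) r)ᶜ,
      posPow s (z (Fin.last d)) * fracKernel s z := by
  rw [setIntegral_pos_iff_support_of_nonneg_ae
    (ae_of_all _ fun z => mul_nonneg (posPow_nonneg _) (fracKernel_nonneg z))
    (integrableOn_posPow_last hs0 hs1 hr)]
  have hlast : Continuous fun z : EuclideanSpace ℝ (Fin (d + 1)) => z (Fin.last d) := by fun_prop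
  have hopen : IsOpen ({z : EuclideanSpace ℝ (Fin (d + 1)) | 0 < z (Fin.last d)} ∩ {z | r < ‖z‖}) :=
    (isOpen_lt continuous_const hlast).inter (isOpen_lt continuous_const continuous_norm)
  refine (hopen.measure_pos volume ⟨EuclideanSpace.single (Fin.last d) (r + 1), ?_, ?_⟩).trans_le
    (measure_mono ?_)
  · simp; linarith
  · have : |r + 1| = r + 1 := abs_of_pos (by linarith)
    simp [this]
  · rintro z ⟨h1, h2⟩
    refine ⟨?_, by simpa using h2.le⟩
    have hz : z ≠ 0 := norm_pos_iff.1 (hr.trans h2)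
    rw [Function.mem_support, posPow_of_pos h1]
    exact (mul_pos (Real.rpow_pos_of_pos h1 _) (fracKernel_pos hz)).ne'

/-- The barrier `A (x_n)₊^s + ε (x_n)₊^{s-1} + D |x - b|²`. -/
noncomputable def barrier {d : ℕ} (s A ε D : ℝ) (b x : EuclideanSpace ℝ (Fin (d + 1))) : ℝ :=
  A * posPow s (x (Fin.last d)) + ε * posPow (s - 1) (x (Fin.last d)) + D * ‖x - b‖ ^ 2

lemma barrier_nonneg {A ε D : ℝ} (hA : 0 ≤ A) (hε : 0 ≤ ε) (hD : 0 ≤ D)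
    (b x : EuclideanSpace ℝ (Fin (d + 1))) : 0 ≤ barrier s A ε D b x := by
  have h1 := posPow_nonneg (p := s) (x (Fin.last d))
  have h2 := posPow_nonneg (p := s - 1) (x (Fin.last d))
  unfold barrier
  positivity

lemma continuousAt_barrier {A ε D : ℝ} {b x : EuclideanSpace ℝ (Fin (d + 1))}
    (hx : x ∈ halfSpace d) : ContinuousAt (barrier s A ε D b) x := by
  have hx : 0 < x (Fin.last d) := hx
  have hlast : Continuous fun z : EuclideanSpace ℝ (Fin (d + 1)) => z (Fin.last d) := by fun_prop
  have hpow (p : ℝ) : ContinuousAt (fun z : EuclideanSpace ℝ (Fin (d + 1)) =>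
      posPow p (z (Fin.last d))) x := by
    have h : ContinuousAt (fun z : EuclideanSpace ℝ (Fin (d + 1)) => z (Fin.last d) ^ p) x :=
      hlast.continuousAt.rpow_const (Or.inl hx.ne')
    refine h.congr ?_
    filter_upwards [hlast.continuousAt.eventually (lt_mem_nhds hx)] with z hz
    rw [posPow_of_pos hz]
  exact ((continuousAt_const.mul (hpow s)).add (continuousAt_const.mul (hpow (s - 1)))).add
    (by fun_prop)

/-- If `u` exceeds the barrier somewhere near `b`, then the difference has an interior maximum. -/
lemma exists_max_sub_barrier (hs1 : s < 1) {u f : EuclideanSpace ℝ (Fin (d + 1)) → ℝ}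
    (hsol : IsNonnegSolution s u f) {R M A ε D : ℝ} (hR : 0 < R) (hA : 0 ≤ A) (hε : 0 < ε)
    (hD0 : 0 ≤ D) (hD : M < D * (R / 4) ^ 2) {b : EuclideanSpace ℝ (Fin (d + 1))}
    (hM : ∀ x ∈ Metric.ball b R, u x ≤ M)
    {y : EuclideanSpace ℝ (Fin (d + 1))} (hy : y ∈ Metric.ball b (R / 2))
    (hyu : barrier s A ε D b y < u y) :
    ∃ x ∈ Metric.ball b (R / 4) ∩ halfSpace d, barrier s A ε D b x < u x ∧
      ∀ w ∈ Metric.ball b (R / 2), u w - barrier s A ε D b w ≤ u x - barrier s A ε D b x := by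
  have hM0 : 0 ≤ M := (hsol.nonneg b).trans (hM b (Metric.mem_ball_self hR))
  -- The solution of `ε τ^{s-1} = M + 1`. As `s - 1 < 0`, the singular term exceeds `M` below height
  -- `τ`, so contact can only occur on a compact set inside the half space.
  set τ : ℝ := ((M + 1) / ε) ^ (s - 1)⁻¹ with hτ
  have hτ0 : 0 < τ := by positivity
  have hτs : τ ^ (s - 1) = (M + 1) / ε :=
    Real.rpow_inv_rpow (by positivity) (by linarith)
  have hlast : Continuous fun z : EuclideanSpace ℝ (Fin (d + 1)) => z (Fin.last d) := by fun_prop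
  set S : Set (EuclideanSpace ℝ (Fin (d + 1))) :=
    Metric.closedBall b (R / 4) ∩ {x | τ ≤ x (Fin.last d)} with hS
  have hScomp : IsCompact S :=
    (isCompact_closedBall b (R / 4)).inter_right (isClosed_le continuous_const hlast)
  have hShalf : ∀ x ∈ S, x ∈ halfSpace d := fun x hx => hτ0.trans_le hx.2
  have hkey : ∀ w ∈ Metric.ball b (R / 2), barrier s A ε D b w < u w →
      w ∈ S ∧ w ∈ Metric.ball b (R / 4) := by
    intro w hw hwu
    have hwM := hM w (Metric.ball_subset_ball (by linarith) hw)
    have h1 := mul_nonneg hA (posPow_nonneg (p := s) (w (Fin.last d)))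
    have h2 := mul_nonneg hε.le (posPow_nonneg (p := s - 1) (w (Fin.last d)))
    have h3 := mul_nonneg hD0 (sq_nonneg ‖w - b‖)
    have hwhalf : 0 < w (Fin.last d) := by
      by_contra hcon
      rw [hsol.exterior w hcon] at hwu
      exact absurd (barrier_nonneg hA hε.le hD0 b w) (not_le.2 hwu)
    have hb1 : w ∈ Metric.ball b (R / 4) := by
      rw [mem_ball_iff_norm]
      by_contra! hcon
      have h4 : (R / 4) ^ 2 ≤ ‖w - b‖ ^ 2 := by gcongr
      have h5 := mul_le_mul_of_nonneg_left h4 hD0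
      unfold barrier at hwu
      linarith
    refine ⟨⟨Metric.ball_subset_closedBall hb1, ?_⟩, hb1⟩
    change τ ≤ w (Fin.last d)
    by_contra! hcon
    have h4 : τ ^ (s - 1) ≤ w (Fin.last d) ^ (s - 1) :=
      Real.rpow_le_rpow_of_nonpos hwhalf hcon.le (by linarith)
    rw [hτs, ← posPow_of_pos (p := s - 1) hwhalf, div_le_iff₀' hε] at h4
    unfold barrier at hwu
    linarith
  obtain ⟨x, hxS, hmax⟩ := hScomp.exists_isMaxOn ⟨y, (hkey y hy hyu).1⟩
    (f := fun x => u x - barrier s A ε D b x) fun x hx =>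
      ((hsol.c11.continuousAt (hShalf x hx)).sub
        (continuousAt_barrier (hShalf x hx))).continuousWithinAt
  have hxy : u y - barrier s A ε D b y ≤ u x - barrier s A ε D b x := hmax (hkey y hy hyu).1
  have hxb : x ∈ Metric.ball b (R / 2) := Metric.closedBall_subset_ball (by linarith) hxS.1
  refine ⟨x, ⟨(hkey x hxb (by linarith)).2, hShalf x hxS⟩, by linarith, fun w hw => ?_⟩
  rcases lt_or_ge (barrier s A ε D b w) (u w) with h | h
  · exact hmax (hkey w hw h).1
  · linarith

/-- Growth of solutions along the inner normal at a boundary point. -/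
lemma exists_normal_growth (hs0 : 0 < s) (hs1 : s < 1) {R : ℝ} (hR : 0 < R) (M N : ℝ) :
    ∃ C, 0 ≤ C ∧ ∀ u f : EuclideanSpace ℝ (Fin (d + 1)) → ℝ, IsNonnegSolution s u f →
      ∀ b : EuclideanSpace ℝ (Fin (d + 1)), b (Fin.last d) = 0 →
      (∀ x ∈ Metric.ball b R, u x ≤ M) → (∀ x ∈ Metric.ball b R ∩ halfSpace d, |f x| ≤ N) →
      ∀ t ∈ Set.Ioo 0 (R / 2), u (b + EuclideanSpace.single (Fin.last d) t) ≤ C * t ^ s := by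
  have hc := fracLapConst_pos (n := d + 1) hs0 hs1
  have hR4 : 0 < R / 4 := by positivity
  obtain ⟨T, hT0, hT⟩ := exists_tail_bound (d := d) hs0 hs1 hR M N hR4
  -- Gives `D (R/4)² = M + 1 > M`: contact lies in `B_{R/4}(b)`, leaving room `R/4` inside the ball
  -- where the maximum is taken.
  set D : ℝ := 16 * (M + 1) / R ^ 2 with hD
  set c₁ := ∫ z in (Metric.ball (0 : EuclideanSpace ℝ (Fin (d + 1))) (R / 4))ᶜ,
    posPow s (z (Fin.last d)) * fracKernel s z with hc₁
  have hc₁0 : 0 < c₁ := integral_posPow_last_pos hs0 hs1 hR4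
  set c₂ := ∫ z in Metric.ball (0 : EuclideanSpace ℝ (Fin (d + 1))) (R / 4),
    ‖z‖ ^ 2 * fracKernel s z with hc₂
  set c₃ := ∫ z in (Metric.ball (0 : EuclideanSpace ℝ (Fin (d + 1))) (R / 4))ᶜ, fracKernel s z
    with hc₃
  set B := D * c₂ + M * c₃ + T + N / fracLapConst (d + 1) s with hB
  set A : ℝ := max 0 ((B + 1) / c₁) with hA
  have hA0 : 0 ≤ A := le_max_left _ _
  have hAB : B < A * c₁ := by
    have : (B + 1) / c₁ ≤ A := le_max_right _ _
    rw [div_le_iff₀ hc₁0] at this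
    linarith
  -- The second summand absorbs `D t² = D t^{2-s} t^s`. The absolute value is needed because the
  -- sign of `M` is known only once a solution is given.
  refine ⟨A + |D| * (R / 2) ^ (2 - s), by positivity, fun u f hsol b hb hM hN t ht => ?_⟩
  have hM0 : 0 ≤ M := (hsol.nonneg b).trans (hM b (Metric.mem_ball_self hR))
  have hD0 : 0 ≤ D := by positivity
  have hDR : M < D * (R / 4) ^ 2 := by
    have : D * (R / 4) ^ 2 = M + 1 := by rw [hD]; field_simp; norm_num
    linarith
  have hcomp : ∀ ε > 0, ∀ y ∈ Metric.ball b (R / 2), u y ≤ barrier s A ε D b y := by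
    intro ε hε y hy
    by_contra! hcon
    obtain ⟨x, ⟨hxb, hxh⟩, hxu, hmax⟩ :=
      exists_max_sub_barrier hs1 hsol hR hA0 hε hD0 hDR hM hy hcon
    have hx0 : 0 < x (Fin.last d) := hxh
    have hxR : x ∈ Metric.ball b R := Metric.ball_subset_ball (by linarith) hxb
    have hP := hsol.hasPV hs0 hs1 hxh
    have hshift := hsol.memL2s.integrableOn_shift hs0 x hR4
    have hKM := Integrable.const_mul (integrableOn_fracKernel (n := d + 1) hs0 hR4) M
    have hpow := Integrable.const_mul (integrableOn_posPow_last (d := d) hs0 hs1 hR4) A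
    -- Outside `B_{R/4}` the lower function may carry the extra term `A (z_n)₊^s`, because `(x_n +
    -- z_n)₊^s ≥ (z_n)₊^s`. Its integral is `A c₁`, while the harmonic terms contribute zero.
    have hQ := ((((hasPV_posPow (d := d) hs0 hs1 (Or.inl rfl) hx0).const_mul A).add
      ((hasPV_posPow (d := d) hs0 hs1 (Or.inr rfl) hx0).const_mul ε)).sub
      ((hasPV_quadratic (r := R / 4) hs0 hs1 (x - b)).const_mul D)).add
      (HasPV.of_integrableOn_compl
        (p := fun z => A * posPow s (z (Fin.last d)) - M - u (x + z)) d.succ_ne_zero (by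
          simp only [sub_mul, mul_assoc]
          exact (hpow.sub hKM).sub hshift))
    have hle := hQ.mono hP fun z => by
      have hlz : (x + z) (Fin.last d) = x (Fin.last d) + z (Fin.last d) := rfl
      by_cases hz : z ∈ Metric.ball 0 (R / 4)
      · rw [Set.indicator_of_mem hz, Set.indicator_of_notMem (by simpa using hz), add_zero]
        have hxz : x + z ∈ Metric.ball b (R / 2) := by
          rw [mem_ball_iff_norm, show x + z - b = (x - b) + z by abel]
          have := norm_add_le (x - b) z
          have := mem_ball_zero_iff.1 hz
          have := mem_ball_iff_norm.1 hxb
          linarith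
        have h1 := hmax _ hxz
        unfold barrier at h1
        rw [norm_add_sub_sq, hlz] at h1
        linarith
      · rw [Set.indicator_of_notMem hz, Set.indicator_of_mem (by simpa using hz)]
        have h1 : posPow s (z (Fin.last d)) ≤ posPow s (x (Fin.last d) + z (Fin.last d)) :=
          posPow_mono hs0.le (by linarith)
        have h2 := mul_le_mul_of_nonneg_left h1 hA0
        have h3 := mul_nonneg hε.le (posPow_nonneg (p := s - 1) (x (Fin.last d) + z (Fin.last d)))
        have h4 := hM x hxR
        have h5 := hsol.nonneg x
        have h6 := mul_nonneg hD0 (sq_nonneg ‖x - b‖)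
        unfold barrier at hxu
        linarith
    simp only [sub_mul, mul_assoc] at hle
    have hdiff : IntegrableOn (fun z : EuclideanSpace ℝ (Fin (d + 1)) =>
        A * (posPow s (z (Fin.last d)) * fracKernel s z) - M * fracKernel s z)
        (Metric.ball 0 (R / 4))ᶜ := hpow.sub hKM
    rw [integral_sub hdiff hshift, integral_sub hpow hKM, integral_const_mul,
      integral_const_mul, ← hc₃, ← hc₁] at hle
    have hf : f x / fracLapConst (d + 1) s ≤ N / fracLapConst (d + 1) s := by
      gcongr
      exact (abs_le.1 (hN x ⟨hxR, hxh⟩)).2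
    have := hT u f hsol b hb hM hN x hxR
    linarith
  obtain ⟨ht0, htR⟩ := ht
  set y := b + EuclideanSpace.single (Fin.last d) t with hy
  have hyl : y (Fin.last d) = t := by simp [hy, hb]
  have hyb : ‖y - b‖ = t := by
    rw [hy, add_sub_cancel_left]
    simp [abs_of_pos ht0]
  have hle : ∀ ε > 0, u y ≤ A * t ^ s + D * t ^ 2 + ε * t ^ (s - 1) := by
    intro ε hε
    have h := hcomp ε hε y (by rw [mem_ball_iff_norm, hyb]; exact htR)
    rw [barrier, hyl, hyb, posPow_of_pos ht0, posPow_of_pos ht0] at h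
    linarith
  have hlim : u y ≤ A * t ^ s + D * t ^ 2 := by
    have h1 : Tendsto (fun ε : ℝ => A * t ^ s + D * t ^ 2 + ε * t ^ (s - 1)) (𝓝[>] 0)
        (𝓝 (A * t ^ s + D * t ^ 2 + 0 * t ^ (s - 1))) :=
      (Continuous.tendsto (by fun_prop) 0).mono_left nhdsWithin_le_nhds
    rw [zero_mul, add_zero] at h1
    refine ge_of_tendsto h1 ?_
    filter_upwards [self_mem_nhdsWithin] with ε hε using hle ε hε
  refine hlim.trans ?_
  rw [add_mul, abs_of_nonneg hD0, mul_assoc]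
  have e1 : t ^ 2 = t ^ (2 - s) * t ^ s := by
    rw [← Real.rpow_add ht0, sub_add_cancel]; norm_num
  have h2 : t ^ (2 - s) ≤ (R / 2) ^ (2 - s) :=
    Real.rpow_le_rpow ht0.le htR.le (by linarith)
  rw [e1]
  gcongr

/-- Growth like `x_n^s` near the boundary. -/
lemma exists_boundary_growth (hs0 : 0 < s) (hs1 : s < 1) {R : ℝ} (hR : 0 < R) (M N : ℝ) :
    ∃ C, 0 ≤ C ∧ ∀ u f : EuclideanSpace ℝ (Fin (d + 1)) → ℝ, IsNonnegSolution s u f →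
      ∀ x₀ : EuclideanSpace ℝ (Fin (d + 1)), x₀ (Fin.last d) = 0 →
      (∀ x ∈ Metric.ball x₀ R, u x ≤ M) → (∀ x ∈ Metric.ball x₀ R ∩ halfSpace d, |f x| ≤ N) →
      ∀ x ∈ Metric.ball x₀ (7 * R / 8), u x ≤ C * posPow s (x (Fin.last d)) := by
  obtain ⟨C, hC0, hC⟩ := exists_normal_growth (d := d) hs0 hs1 (by positivity : 0 < R / 16) M N
  refine ⟨C + |M| * (32 / R) ^ s, by positivity, fun u f hsol x₀ hx₀ hM hN x hx => ?_⟩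
  have hM0 : 0 ≤ M := (hsol.nonneg x₀).trans (hM x₀ (Metric.mem_ball_self hR))
  rw [abs_of_nonneg hM0]
  rcases le_or_gt (x (Fin.last d)) 0 with h0 | h0
  · rw [hsol.exterior x (not_lt.2 h0), posPow_of_nonpos h0, mul_zero]
  rw [posPow_of_pos h0, add_mul]
  have hp := Real.rpow_pos_of_pos h0 s
  -- At height at least `R/32` the bound `u ≤ M` suffices; below it, the growth estimate is applied
  -- at the foot of the perpendicular, whose ball of radius `R/16` stays in `B_R(x₀)`.
  rcases le_or_gt (R / 32) (x (Fin.last d)) with h1 | h1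
  · have h2 := hM x (Metric.ball_subset_ball (by linarith) hx)
    have h3 : 1 ≤ (32 / R * x (Fin.last d)) ^ s := by
      refine Real.one_le_rpow ?_ hs0.le
      rw [div_mul_eq_mul_div, one_le_div hR]
      linarith
    rw [Real.mul_rpow (by positivity) h0.le] at h3
    have h4 := mul_le_mul_of_nonneg_left h3 hM0
    have h5 := mul_nonneg hC0 hp.le
    linarith
  · set b := x - EuclideanSpace.single (Fin.last d) (x (Fin.last d)) with hb
    have hbl : b (Fin.last d) = 0 := by simp [hb]
    have hxb : b + EuclideanSpace.single (Fin.last d) (x (Fin.last d)) = x := by simp [hb]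
    have hsub : Metric.ball b (R / 16) ⊆ Metric.ball x₀ R := by
      intro w hw
      rw [mem_ball_iff_norm] at hw hx ⊢
      have h2 := norm_sub_le_norm_sub_add_norm_sub w b x₀
      have h3 := norm_sub_le_norm_sub_add_norm_sub b x x₀
      have h4 : ‖b - x‖ = x (Fin.last d) := by
        rw [hb, sub_sub_cancel_left, norm_neg]
        simp [abs_of_pos h0]
      linarith
    have h2 := hC u f hsol b hbl (fun w hw => hM w (hsub hw))
      (fun w hw => hN w ⟨hsub hw.1, hw.2⟩) (x (Fin.last d)) ⟨h0, by linarith⟩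
    rw [hxb] at h2
    have h3 := mul_nonneg (mul_nonneg hM0 (by positivity : 0 ≤ (32 / R) ^ s)) hp.le
    linarith

end Barrier

/-! ### Concavity of the power and directional second moments. -/

/-- Quantitative concavity of the power `s ∈ (0,1)` near `1`. -/
lemma one_add_rpow_le_sub_sq {s : ℝ} (hs0 : 0 < s) (hs1 : s < 1) {τ : ℝ} (hτ : |τ| ≤ 1 / 2) :
    (1 + τ) ^ s ≤ 1 + s * τ - s * (1 - s) / 4 * τ ^ 2 := by
  obtain ⟨hl, hr⟩ := abs_le.1 hτ
  set φ : ℝ → ℝ := fun τ => 1 + s * τ - s * (1 - s) / 4 * τ ^ 2 - (1 + τ) ^ s with hφ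
  have hss : 0 < s * (1 - s) := mul_pos hs0 (by linarith)
  have hd : ∀ x : ℝ, -1 < x →
      HasDerivAt φ (s - s * (1 - s) / 2 * x - s * (1 + x) ^ (s - 1)) x := by
    intro x hx
    have h1 : HasDerivAt (fun x : ℝ => (1 + x) ^ s) (1 * s * (1 + x) ^ (s - 1)) x :=
      ((hasDerivAt_id x).const_add 1).rpow_const (Or.inl (by simp only [id]; linarith))
    have h2 : HasDerivAt (fun x : ℝ => 1 + s * x) (s * 1) x :=
      ((hasDerivAt_id x).const_mul s).const_add 1
    have h3 : HasDerivAt (fun x : ℝ => s * (1 - s) / 4 * x ^ 2)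
        (s * (1 - s) / 4 * (2 * x)) x := by
      simpa using (hasDerivAt_pow 2 x).const_mul (s * (1 - s) / 4)
    refine ((h2.sub h3).sub h1).congr_deriv ?_
    ring
  have hφ0 : φ 0 = 0 := by simp [hφ]
  suffices h : 0 ≤ φ τ by
    simp only [hφ] at h
    linarith
  -- On each side of `0` the sign of the derivative of `φ` follows from Bernoulli's inequality, with
  -- exponent `s` on the right and `1 - s` on the left.
  rcases le_total 0 τ with h0 | h0
  · have hmono : MonotoneOn φ (Set.Icc 0 (1 / 2)) := by
      refine monotoneOn_of_deriv_nonneg (convex_Icc _ _) (fun x hx => ?_) (fun x hx => ?_)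
        fun x hx => ?_
      · exact (hd x (by linarith [hx.1])).continuousAt.continuousWithinAt
      · rw [interior_Icc] at hx
        exact (hd x (by linarith [hx.1])).differentiableAt.differentiableWithinAt
      · rw [interior_Icc] at hx
        have hx0 : 0 < x := hx.1
        have hx1 : x < 1 / 2 := hx.2
        rw [(hd x (by linarith)).deriv]
        have h1 := rpow_one_add_le_one_add_mul_self (by linarith : -1 ≤ x) hs0.le hs1.le
        have h2 : (1 + x) ^ (s - 1) ≤ (1 + s * x) / (1 + x) := by
          rw [Real.rpow_sub_one (by linarith)]
          exact div_le_div_of_nonneg_right h1 (by linarith)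
        have h3 : (1 + s * x) / (1 + x) ≤ 1 - (1 - s) / 2 * x := by
          rw [div_le_iff₀ (by linarith)]
          nlinarith [mul_pos (by linarith : 0 < 1 - s) hx0,
            mul_pos (mul_pos (by linarith : 0 < 1 - s) hx0) (by linarith : 0 < 1 - x)]
        have h4 := mul_le_mul_of_nonneg_left (h2.trans h3) hs0.le
        linarith
    have := hmono ⟨le_rfl, by norm_num⟩ ⟨h0, hr⟩ h0
    rwa [hφ0] at this
  · have hanti : AntitoneOn φ (Set.Icc (-(1 / 2)) 0) := by
      refine antitoneOn_of_deriv_nonpos (convex_Icc _ _) (fun x hx => ?_) (fun x hx => ?_)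
        fun x hx => ?_
      · exact (hd x (by linarith [hx.1])).continuousAt.continuousWithinAt
      · rw [interior_Icc] at hx
        exact (hd x (by linarith [hx.1])).differentiableAt.differentiableWithinAt
      · rw [interior_Icc] at hx
        have hx0 : -(1 / 2) < x := hx.1
        have hx1 : x < 0 := hx.2
        rw [(hd x (by linarith)).deriv]
        have h1 := rpow_one_add_le_one_add_mul_self (by linarith : -1 ≤ x)
          (by linarith : 0 ≤ 1 - s) (by linarith)
        have hpos : 0 < (1 + x) ^ (1 - s) := Real.rpow_pos_of_pos (by linarith) _
        have h2 : 1 - (1 - s) * x ≤ (1 + x) ^ (s - 1) := by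
          rw [show s - 1 = -(1 - s) by ring, Real.rpow_neg (by linarith), ← one_div,
            le_div_iff₀ hpos]
          have h3 : 0 ≤ 1 - (1 - s) * x := by nlinarith
          have h4 := mul_le_mul_of_nonneg_left h1 h3
          nlinarith [sq_nonneg ((1 - s) * x)]
        have h5 := mul_le_mul_of_nonneg_left h2 hs0.le
        nlinarith
    have := hanti ⟨hl, h0⟩ ⟨by norm_num, le_rfl⟩ h0
    rwa [hφ0] at this

section Moments

variable {d : ℕ} {s : ℝ}

/-- The second moment of the kernel over the unit ball in one direction. -/
noncomputable def directionalMoment (d : ℕ) (s : ℝ) : ℝ :=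
  ∫ z in Metric.ball (0 : EuclideanSpace ℝ (Fin (d + 1))) 1, z (Fin.last d) ^ 2 * fracKernel s z

lemma integrableOn_last_sq_mul_fracKernel (hs1 : s < 1) (r : ℝ) :
    IntegrableOn (fun z : EuclideanSpace ℝ (Fin (d + 1)) => z (Fin.last d) ^ 2 * fracKernel s z)
      (Metric.ball 0 r) := by
  refine (integrableOn_sq_mul_fracKernel hs1 r).mono' ?_ (ae_of_all _ fun z => ?_)
  · have hlast : Measurable fun z : EuclideanSpace ℝ (Fin (d + 1)) => z (Fin.last d) := by fun_prop
    exact ((hlast.pow_const 2).mul measurable_fracKernel).aestronglyMeasurable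
  · rw [Real.norm_of_nonneg (mul_nonneg (sq_nonneg _) (fracKernel_nonneg z))]
    refine mul_le_mul_of_nonneg_right ?_ (fracKernel_nonneg z)
    rw [← sq_abs]
    have := abs_last_le_norm z
    gcongr

lemma directionalMoment_pos (hs1 : s < 1) : 0 < directionalMoment d s := by
  rw [directionalMoment, setIntegral_pos_iff_support_of_nonneg_ae
    (ae_of_all _ fun z => mul_nonneg (sq_nonneg _) (fracKernel_nonneg z))
    (integrableOn_last_sq_mul_fracKernel hs1 1)]
  have hlast : Continuous fun z : EuclideanSpace ℝ (Fin (d + 1)) => z (Fin.last d) := by fun_prop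
  have hopen : IsOpen ({z : EuclideanSpace ℝ (Fin (d + 1)) | 0 < z (Fin.last d)} ∩
      Metric.ball 0 1) := (isOpen_lt continuous_const hlast).inter Metric.isOpen_ball
  refine (hopen.measure_pos volume ⟨EuclideanSpace.single (Fin.last d) (1 / 2), ?_, ?_⟩).trans_le
    (measure_mono ?_)
  · simp
  · rw [mem_ball_zero_iff]
    simp
    norm_num
  · rintro z ⟨h1, h2⟩
    refine ⟨?_, h2⟩
    have h1 : 0 < z (Fin.last d) := h1
    have hz : z ≠ 0 := by
      rintro rfl
      simp at h1
    exact (mul_pos (by positivity) (fracKernel_pos hz)).ne'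

lemma integral_last_sq_mul_fracKernel {r : ℝ} (hr : 0 < r) :
    ∫ z in Metric.ball (0 : EuclideanSpace ℝ (Fin (d + 1))) r,
      z (Fin.last d) ^ 2 * fracKernel s z = r ^ (2 - 2 * s) * directionalMoment d s := by
  have h := Measure.setIntegral_comp_smul_of_pos volume
    (fun z : EuclideanSpace ℝ (Fin (d + 1)) => z (Fin.last d) ^ 2 * fracKernel s z)
    (Metric.ball 0 1) hr
  rw [smul_unitBall hr.ne', Real.norm_of_nonneg hr.le, finrank_euclideanSpace, Fintype.card_fin,
    smul_eq_mul] at h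
  have he (z : EuclideanSpace ℝ (Fin (d + 1))) :
      (r • z) (Fin.last d) ^ 2 * fracKernel s (r • z) =
        r ^ (2 - (((d + 1 : ℕ) : ℝ) + 2 * s)) * (z (Fin.last d) ^ 2 * fracKernel s z) := by
    rw [fracKernel, fracKernel, norm_smul, Real.norm_of_nonneg hr.le,
      Real.mul_rpow hr.le (norm_nonneg z), Real.rpow_sub hr, PiLp.smul_apply, smul_eq_mul,
      Real.rpow_two, mul_inv]
    ring
  simp only [he] at h
  rw [integral_const_mul, eq_inv_mul_iff_mul_eq₀ (by positivity)] at h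
  rw [← h, directionalMoment, ← mul_assoc, ← Real.rpow_natCast, ← Real.rpow_add hr]
  congr 2
  ring

lemma hasPV_inner_sq (hs1 : s < 1) {r : ℝ} (hr : 0 < r) {e : EuclideanSpace ℝ (Fin (d + 1))}
    (he : ‖e‖ = 1) :
    HasPV s ((Metric.ball 0 r).indicator fun z => inner ℝ z e ^ 2)
      (r ^ (2 - 2 * s) * directionalMoment d s) := by
  have h := HasPV.of_integrableOn_ball (n := d + 1) d.succ_ne_zero
    (integrableOn_last_sq_mul_fracKernel (d := d) hs1 r)
  rw [integral_last_sq_mul_fracKernel hr] at h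
  set eₙ : EuclideanSpace ℝ (Fin (d + 1)) := EuclideanSpace.single (Fin.last d) 1 with heₙ
  have hn : ‖e‖ = ‖eₙ‖ := by rw [he, heₙ]; simp
  -- This reflection sends `e` to `eₙ`, so the moment does not depend on the direction.
  convert h.comp_isometry (Submodule.reflection (ℝ ∙ (e - eₙ))ᗮ) using 1
  ext z
  have hin : (Submodule.reflection (ℝ ∙ (e - eₙ))ᗮ z) (Fin.last d) = inner ℝ z e := by
    have h1 := (Submodule.reflection (ℝ ∙ (e - eₙ))ᗮ).inner_map_map z e
    rw [Submodule.reflection_sub hn] at h1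
    rw [← h1, heₙ, EuclideanSpace.inner_single_right]
    simp
  by_cases hz : z ∈ Metric.ball 0 r
  · rw [Set.indicator_of_mem hz, Set.indicator_of_mem (by simpa using hz), hin]
  · rw [Set.indicator_of_notMem hz, Set.indicator_of_notMem (by simpa using hz)]

end Moments

/-! ### Hölder estimate by doubling of variables. -/

section Doubling

variable {d : ℕ} {s : ℝ}

/-- Increment of `|·|^s` when the displacement is changed along its own direction. -/
lemma norm_rpow_mirror_le (hs0 : 0 < s) (hs1 : s < 1) {E : Type*} [NormedAddCommGroup E]
    [InnerProductSpace ℝ E] {a e z w : E} (ha : a ≠ 0) (hae : a = ‖a‖ • e) (he : ‖e‖ = 1)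
    (hz : ‖z‖ < ‖a‖ / 4) (hw : z - w = (2 * inner ℝ z e) • e) :
    ‖a + (z - w)‖ ^ s ≤ ‖a‖ ^ s + 2 * (s * ‖a‖ ^ (s - 1)) * inner ℝ z e -
      s * (1 - s) * ‖a‖ ^ (s - 2) * inner ℝ z e ^ 2 := by
  have ha0 : 0 < ‖a‖ := norm_pos_iff.2 ha
  set t : ℝ := inner ℝ z e with ht
  have htz : |t| ≤ ‖a‖ / 4 := by
    have := abs_real_inner_le_norm z e
    rw [he, mul_one] at this
    linarith
  -- The radius `‖a‖/4` is what keeps the relative displacement in the range of the concavity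
  -- estimate.
  have hτ : |2 * t / ‖a‖| ≤ 1 / 2 := by
    rw [abs_div, abs_of_pos ha0, div_le_iff₀ ha0, abs_mul, abs_two]
    linarith
  have e1 : a + (z - w) = (‖a‖ * (1 + 2 * t / ‖a‖)) • e := by
    nth_rewrite 1 [hae]
    rw [hw, ← add_smul]
    congr 1
    field_simp
  have h1 : 0 ≤ 1 + 2 * t / ‖a‖ := by linarith [(abs_le.1 hτ).1]
  rw [e1, norm_smul, he, mul_one, Real.norm_of_nonneg (by positivity), Real.mul_rpow ha0.le h1]
  refine (mul_le_mul_of_nonneg_left (one_add_rpow_le_sub_sq hs0 hs1 hτ) (by positivity)).trans_eq ?_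
  rw [Real.rpow_sub_one ha0.ne', Real.rpow_sub ha0, Real.rpow_two]
  field_simp
  ring

/-- At an interior maximum of `u x - u y - L |x - y|^s - A |x - c|²`, the equation bounds `L`. -/
lemma doubling_estimate (hs0 : 0 < s) (hs1 : s < 1) {u f : EuclideanSpace ℝ (Fin (d + 1)) → ℝ}
    (hsol : IsNonnegSolution s u f) {r A L T N : ℝ} (hr : 0 < r) (hL : 0 ≤ L)
    {c x y : EuclideanSpace ℝ (Fin (d + 1))} (hx : x ∈ halfSpace d) (hy : y ∈ halfSpace d)
    (hxy : x ≠ y) (hxyr : ‖x - y‖ ≤ r) (hfx : |f x| ≤ N) (hfy : |f y| ≤ N)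
    (hT : ∫ z in (Metric.ball 0 r)ᶜ, u (x + z) * fracKernel s z ≤ T) (huxy : u y ≤ u x)
    (hmax : ∀ z w : EuclideanSpace ℝ (Fin (d + 1)), ‖z‖ < r → ‖w‖ < r →
      u (x + z) - u (y + w) - L * ‖x + z - (y + w)‖ ^ s - A * ‖x + z - c‖ ^ 2 ≤
        u x - u y - L * ‖x - y‖ ^ s - A * ‖x - c‖ ^ 2) :
    L * (s * (1 - s)) * 4⁻¹ ^ (2 - 2 * s) * directionalMoment d s * r ^ (-s) ≤
      A * (∫ z in Metric.ball (0 : EuclideanSpace ℝ (Fin (d + 1))) r, ‖z‖ ^ 2 * fracKernel s z) +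
        T + 2 * N / fracLapConst (d + 1) s := by
  have hc := fracLapConst_pos (n := d + 1) hs0 hs1
  set a := x - y with ha
  have ha0 : a ≠ 0 := sub_ne_zero.2 hxy
  have han : 0 < ‖a‖ := norm_pos_iff.2 ha0
  set e := ‖a‖⁻¹ • a with he
  have he1 : ‖e‖ = 1 := by rw [he, norm_smul, norm_inv, norm_norm, inv_mul_cancel₀ han.ne']
  have hae : a = ‖a‖ • e := by rw [he, smul_smul, mul_inv_cancel₀ han.ne', one_smul]
  set ρ := ‖a‖ / 4 with hρ
  have hρ0 : 0 < ρ := by positivity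
  have hρr : ρ < r := by linarith
  -- Mirror coupling: moving `x` by `z` and `y` by `σ z` changes `x - y` only along its own
  -- direction, where `|·|^s` is strictly concave.
  set σ := Submodule.reflection (ℝ ∙ e)ᗮ with hσ
  have hσz (z : EuclideanSpace ℝ (Fin (d + 1))) : z - σ z = (2 * inner ℝ z e) • e := by
    rw [hσ, Submodule.reflection_orthogonal_apply, Submodule.reflection_singleton_apply, he1,
      real_inner_comm, two_smul, two_mul, add_smul]
    simp
  have hP₁ := hsol.hasPV hs0 hs1 hx
  have hP₂ := hsol.hasPV hs0 hs1 hy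
  -- The increments at `y` are reflected inside `B_ρ` only; the principal value there is unchanged.
  have hP₂' := ((hP₂.indicator_ball d.succ_ne_zero hρ0).comp_isometry σ).add
    (HasPV.of_integrableOn_compl d.succ_ne_zero (hP₂.integrableOn ρ hρ0))
  rw [sub_add_cancel] at hP₂'
  have hshift := hsol.memL2s.integrableOn_shift hs0 x hr
  have hQ := (((hasPV_inner_sq hs1 hρ0 he1).const_mul (L * (s * (1 - s)) * ‖a‖ ^ (s - 2))).sub
    ((hasPV_linear (r := ρ) hs0 e).const_mul (L * (s * ‖a‖ ^ (s - 1))))).sub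
    (((hasPV_quadratic (r := r) hs0 hs1 (x - c)).const_mul A).add
      (HasPV.of_integrableOn_compl d.succ_ne_zero hshift))
  have hle := hQ.mono (hP₁.sub hP₂') fun z => by
    by_cases hzρ : z ∈ Metric.ball 0 ρ
    · have hzn : ‖z‖ < ρ := mem_ball_zero_iff.1 hzρ
      have hzr : z ∈ Metric.ball 0 r := mem_ball_zero_iff.2 (by linarith)
      have hσρ : σ z ∈ Metric.ball 0 ρ := by simpa using hzn
      rw [Set.indicator_of_mem hzρ, Set.indicator_of_mem hzρ, Set.indicator_of_mem hzr,
        Set.indicator_of_notMem (by simpa using mem_ball_zero_iff.1 hzr),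
        Set.indicator_of_mem hσρ, Set.indicator_of_notMem (by simpa using hzn)]
      have h1 := hmax z (σ z) (by linarith) (by rw [σ.norm_map]; linarith)
      rw [norm_add_sub_sq, show x + z - (y + σ z) = a + (z - σ z) by rw [ha]; abel] at h1
      have h2 := mul_le_mul_of_nonneg_left
        (norm_rpow_mirror_le hs0 hs1 ha0 hae he1 hzn (hσz z)) hL
      linarith
    · have hzn : ρ ≤ ‖z‖ := by simpa using hzρ
      have hσρ : σ z ∉ Metric.ball 0 ρ := by simpa using hzn
      rw [Set.indicator_of_notMem hzρ, Set.indicator_of_notMem hzρ, Set.indicator_of_notMem hσρ,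
        Set.indicator_of_mem (Set.mem_compl hzρ)]
      by_cases hzr : z ∈ Metric.ball 0 r
      · rw [Set.indicator_of_mem hzr,
          Set.indicator_of_notMem (by simpa using mem_ball_zero_iff.1 hzr)]
        have hz := mem_ball_zero_iff.1 hzr
        -- Equal increments leave `x - y` fixed, so only the quadratic penalty changes.
        have h1 := hmax z z hz hz
        rw [norm_add_sub_sq, add_sub_add_right_eq_sub] at h1
        linarith
      · rw [Set.indicator_of_notMem hzr, Set.indicator_of_mem (by simpa using hzr)]
        linarith [hsol.nonneg (y + z)]
  have hfx' : f x / fracLapConst (d + 1) s ≤ N / fracLapConst (d + 1) s := by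
    gcongr
    exact (abs_le.1 hfx).2
  have hfy' : -(N / fracLapConst (d + 1) s) ≤ f y / fracLapConst (d + 1) s := by
    rw [← neg_div]
    gcongr
    exact (abs_le.1 hfy).1
  -- With `ρ` proportional to `‖a‖` the gain scales like `‖a‖^{-s}`, hence is at least its value at
  -- `‖a‖ = r`.
  have e1 : ‖a‖ ^ (s - 2) * ρ ^ (2 - 2 * s) = 4⁻¹ ^ (2 - 2 * s) * ‖a‖ ^ (-s) := by
    rw [hρ, div_eq_mul_inv, Real.mul_rpow han.le (by norm_num), ← mul_assoc, ← Real.rpow_add han,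
      mul_comm]
    ring_nf
  have h1 : r ^ (-s) ≤ ‖a‖ ^ (-s) := Real.rpow_le_rpow_of_nonpos han hxyr (by linarith)
  have hm := directionalMoment_pos (d := d) hs1
  have hs1' : 0 < 1 - s := by linarith
  have h2 := mul_le_mul_of_nonneg_left h1
    (by positivity : 0 ≤ L * (s * (1 - s)) * 4⁻¹ ^ (2 - 2 * s) * directionalMoment d s)
  have e2 : L * (s * (1 - s)) * 4⁻¹ ^ (2 - 2 * s) * directionalMoment d s * ‖a‖ ^ (-s) =
      L * (s * (1 - s)) * ‖a‖ ^ (s - 2) * (ρ ^ (2 - 2 * s) * directionalMoment d s) := by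
    linear_combination (-(L * (s * (1 - s)) * directionalMoment d s)) * e1
  rw [mul_div_assoc]
  linarith

lemma posPow_eq_max (hs0 : 0 < s) (y : ℝ) : posPow s y = max y 0 ^ s := by
  rcases le_or_gt y 0 with hy | hy
  · rw [posPow_of_nonpos hy, max_eq_right hy, Real.zero_rpow hs0.ne']
  · rw [posPow_of_pos hy, max_eq_left hy.le]

/-- Solutions with boundary growth `x_n^s` are continuous up to the boundary. -/
lemma IsNonnegSolution.continuousAt_of_growth (hs0 : 0 < s)
    {u f : EuclideanSpace ℝ (Fin (d + 1)) → ℝ} (hsol : IsNonnegSolution s u f)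
    {x₀ : EuclideanSpace ℝ (Fin (d + 1))} {R C : ℝ}
    (hC : ∀ x ∈ Metric.ball x₀ R, u x ≤ C * posPow s (x (Fin.last d)))
    {x : EuclideanSpace ℝ (Fin (d + 1))} (hx : x ∈ Metric.ball x₀ R) : ContinuousAt u x := by
  by_cases hxh : x ∈ halfSpace d
  · exact hsol.c11.continuousAt hxh
  · have hlast : Continuous fun z : EuclideanSpace ℝ (Fin (d + 1)) => z (Fin.last d) := by fun_prop
    have hcont : Continuous fun z : EuclideanSpace ℝ (Fin (d + 1)) =>
        C * posPow s (z (Fin.last d)) := by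
      simp only [posPow_eq_max hs0]
      exact continuous_const.mul
        ((hlast.max continuous_const).rpow_const fun _ => Or.inr hs0.le)
    have hlim := hcont.tendsto x
    rw [posPow_of_nonpos (not_lt.1 hxh), mul_zero] at hlim
    rw [ContinuousAt, hsol.exterior x hxh]
    refine tendsto_of_tendsto_of_tendsto_of_le_of_le' tendsto_const_nhds hlim
      (Eventually.of_forall hsol.nonneg) ?_
    filter_upwards [Metric.isOpen_ball.mem_nhds hx] with z hz using hC z hz

/-- If the Hölder estimate fails, then `u x - u y - L |x - y|^s - A |x - x₁|²` has an interior
positive maximum off the diagonal. -/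
lemma exists_doubling_max (hs0 : 0 < s) {u f : EuclideanSpace ℝ (Fin (d + 1)) → ℝ}
    (hsol : IsNonnegSolution s u f) {r M A C L : ℝ} (hr : 0 < r) (hA0 : 0 ≤ A) (hL0 : 0 ≤ L)
    (hAr : A * r ^ 2 = M + 1) (hLr : M ≤ L * r ^ s) (hLC : C ≤ L)
    {x₀ x₁ y₁ : EuclideanSpace ℝ (Fin (d + 1))} (hM : ∀ x ∈ Metric.ball x₀ (16 * r), u x ≤ M)
    (hgrow : ∀ x ∈ Metric.ball x₀ (14 * r), u x ≤ C * posPow s (x (Fin.last d)))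
    (hx₁ : x₁ ∈ Metric.ball x₀ (8 * r)) (hlt : L * ‖x₁ - y₁‖ ^ s < u x₁ - u y₁) :
    ∃ x ∈ Metric.ball x₀ (16 * r) ∩ halfSpace d, ∃ y ∈ Metric.ball x₀ (16 * r) ∩ halfSpace d,
      x ≠ y ∧ ‖x - y‖ ≤ r ∧ u y ≤ u x ∧
      ∀ z w : EuclideanSpace ℝ (Fin (d + 1)), ‖z‖ < r → ‖w‖ < r →
        u (x + z) - u (y + w) - L * ‖x + z - (y + w)‖ ^ s - A * ‖x + z - x₁‖ ^ 2 ≤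
          u x - u y - L * ‖x - y‖ ^ s - A * ‖x - x₁‖ ^ 2 := by
  have hsub : ∀ x ∈ Metric.closedBall x₁ (4 * r), x ∈ Metric.ball x₀ (14 * r) := by
    intro x hx
    rw [mem_closedBall_iff_norm] at hx
    rw [mem_ball_iff_norm] at hx₁ ⊢
    have := norm_sub_le_norm_sub_add_norm_sub x x₁ x₀
    linarith
  have hsub' : ∀ x ∈ Metric.closedBall x₁ (4 * r), x ∈ Metric.ball x₀ (16 * r) := fun x hx =>
    Metric.ball_subset_ball (by linarith) (hsub x hx)
  have hx₁m : x₁ ∈ Metric.closedBall x₁ (4 * r) := Metric.mem_closedBall_self (by positivity)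
  have hclose (x y : EuclideanSpace ℝ (Fin (d + 1))) (hx : x ∈ Metric.ball x₀ (16 * r))
      (h : L * ‖x - y‖ ^ s < u x - u y) : ‖x - y‖ < r := by
    by_contra! h'
    have h1 : r ^ s ≤ ‖x - y‖ ^ s := Real.rpow_le_rpow hr.le h' hs0.le
    have h2 := mul_le_mul_of_nonneg_left h1 hL0
    linarith [hM x hx, hsol.nonneg y]
  have hy₁m : y₁ ∈ Metric.closedBall x₁ (4 * r) := by
    rw [mem_closedBall_iff_norm, norm_sub_rev]
    linarith [hclose x₁ y₁ (hsub' x₁ hx₁m) hlt]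
  set Φ : EuclideanSpace ℝ (Fin (d + 1)) × EuclideanSpace ℝ (Fin (d + 1)) → ℝ := fun p =>
    u p.1 - u p.2 - L * ‖p.1 - p.2‖ ^ s - A * ‖p.1 - x₁‖ ^ 2 with hΦ
  have hltt : ContinuousOn u (Metric.closedBall x₁ (4 * r)) := fun x hx =>
    (hsol.continuousAt_of_growth hs0 hgrow (hsub x hx)).continuousWithinAt
  have hΦc : ContinuousOn Φ
      (Metric.closedBall x₁ (4 * r) ×ˢ Metric.closedBall x₁ (4 * r)) := by
    have h1 := hltt.comp continuousOn_fst
      (s := Metric.closedBall x₁ (4 * r) ×ˢ Metric.closedBall x₁ (4 * r)) fun p hp => hp.1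
    have h2 := hltt.comp continuousOn_snd
      (s := Metric.closedBall x₁ (4 * r) ×ˢ Metric.closedBall x₁ (4 * r)) fun p hp => hp.2
    have h3 : Continuous fun p : EuclideanSpace ℝ (Fin (d + 1)) × EuclideanSpace ℝ (Fin (d + 1)) =>
        L * ‖p.1 - p.2‖ ^ s := continuous_const.mul
      ((continuous_fst.sub continuous_snd).norm.rpow_const fun _ => Or.inr hs0.le)
    exact ((h1.sub h2).sub h3.continuousOn).sub (by fun_prop)
  obtain ⟨⟨x, y⟩, ⟨hx, hy⟩, hmax⟩ :=
    ((isCompact_closedBall x₁ (4 * r)).prod (isCompact_closedBall x₁ (4 * r))).exists_isMaxOn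
      ⟨(x₁, y₁), hx₁m, hy₁m⟩ hΦc
  have hmax' : ∀ v ∈ Metric.closedBall x₁ (4 * r), ∀ w ∈ Metric.closedBall x₁ (4 * r),
      u v - u w - L * ‖v - w‖ ^ s - A * ‖v - x₁‖ ^ 2 ≤
        u x - u y - L * ‖x - y‖ ^ s - A * ‖x - x₁‖ ^ 2 := fun v hv w hw =>
    hmax (Set.mk_mem_prod hv hw)
  dsimp only at hx hy
  have hpos : 0 < u x - u y - L * ‖x - y‖ ^ s - A * ‖x - x₁‖ ^ 2 := by
    refine lt_of_lt_of_le ?_ (hmax' x₁ hx₁m y₁ hy₁m)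
    rw [sub_self, norm_zero]
    linarith
  have hpen : 0 ≤ A * ‖x - x₁‖ ^ 2 := by positivity
  have hpen' : 0 ≤ L * ‖x - y‖ ^ s := by positivity
  have hxx₁ : ‖x - x₁‖ < r := by
    by_contra! h'
    have h1 : r ^ 2 ≤ ‖x - x₁‖ ^ 2 := by gcongr
    have h2 := mul_le_mul_of_nonneg_left h1 hA0
    linarith [hM x (hsub' x hx), hsol.nonneg y]
  have hxyr : ‖x - y‖ < r := hclose x y (hsub' x hx) (by linarith)
  have hxh : x ∈ halfSpace d := by
    by_contra h'
    have := hsol.exterior x h'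
    linarith [hsol.nonneg y]
  -- If `y_n ≤ 0`, then `x_n ≤ ‖x - y‖`, and growth with `C ≤ L` gives `u x ≤ L ‖x - y‖^s`, against
  -- positivity of the maximum.
  have hyh : y ∈ halfSpace d := by
    by_contra h'
    have hyl : y (Fin.last d) ≤ 0 := not_lt.1 h'
    have hxl : 0 < x (Fin.last d) := hxh
    have h1 : x (Fin.last d) ≤ ‖x - y‖ := by
      have h2 := (abs_le.1 (abs_last_le_norm (x - y))).2
      rw [PiLp.sub_apply] at h2
      linarith
    have h3 := hgrow x (hsub x hx)
    rw [posPow_of_pos hxl] at h3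
    have h4 : C * x (Fin.last d) ^ s ≤ L * ‖x - y‖ ^ s := by gcongr
    linarith [hsol.nonneg y]
  have hxy : x ≠ y := by
    rintro rfl
    linarith
  refine ⟨x, ⟨hsub' x hx, hxh⟩, y, ⟨hsub' y hy, hyh⟩, hxy, hxyr.le, by linarith,
    fun z w hz hw => hmax' _ ?_ _ ?_⟩
  -- As `x` is within `r` of `x₁` and `y` within `r` of `x`, increments shorter than `r` stay in the
  -- ball of radius `4r` over which the maximum was taken.
  · rw [mem_closedBall_iff_norm, show x + z - x₁ = (x - x₁) + z by abel]
    linarith [norm_add_le (x - x₁) z]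
  · rw [mem_closedBall_iff_norm, show y + w - x₁ = (x - x₁) - (x - y) + w by abel]
    linarith [norm_add_le ((x - x₁) - (x - y)) w, norm_sub_le (x - x₁) (x - y)]

/-- Hölder continuity of order `s` up to the boundary. -/
lemma exists_holder (hs0 : 0 < s) (hs1 : s < 1) {R : ℝ} (hR : 0 < R) (M N : ℝ) :
    ∃ C, 0 ≤ C ∧ ∀ u f : EuclideanSpace ℝ (Fin (d + 1)) → ℝ, IsNonnegSolution s u f →
      ∀ x₀ : EuclideanSpace ℝ (Fin (d + 1)), x₀ (Fin.last d) = 0 →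
      (∀ x ∈ Metric.ball x₀ R, u x ≤ M) → (∀ x ∈ Metric.ball x₀ R ∩ halfSpace d, |f x| ≤ N) →
      ∀ x ∈ Metric.ball x₀ (R / 2), ∀ y : EuclideanSpace ℝ (Fin (d + 1)),
        y ∈ Metric.ball x₀ (R / 2) → u x - u y ≤ C * ‖x - y‖ ^ s := by
  have hr : 0 < R / 16 := by positivity
  set r := R / 16 with hrR
  obtain ⟨C₁, hC₁0, hC₁⟩ := exists_boundary_growth (d := d) hs0 hs1 hR M N
  obtain ⟨T, hT0, hT⟩ := exists_tail_bound (d := d) hs0 hs1 hR M N hr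
  set A : ℝ := (|M| + 1) / r ^ 2 with hA
  have hA0 : 0 ≤ A := by positivity
  have hAr : A * r ^ 2 = |M| + 1 := by rw [hA]; field_simp
  set B := A * (∫ z in Metric.ball (0 : EuclideanSpace ℝ (Fin (d + 1))) r,
    ‖z‖ ^ 2 * fracKernel s z) + T + 2 * N / fracLapConst (d + 1) s with hB
  have hm := directionalMoment_pos (d := d) hs1
  have hs1' : 0 < 1 - s := by linarith
  set k := (s * (1 - s)) * 4⁻¹ ^ (2 - 2 * s) * directionalMoment d s * r ^ (-s) with hk
  have hk0 : 0 < k := by positivity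
  -- The summands serve in turn to keep `y` off the boundary, to force `‖x - y‖ < r`, and to
  -- contradict `doubling_estimate`.
  set L := C₁ + |M| * r ^ (-s) + (|B| + 1) / k with hL
  have hL0 : 0 ≤ L := by positivity
  have hLC : C₁ ≤ L := by
    have : 0 ≤ |M| * r ^ (-s) + (|B| + 1) / k := by positivity
    linarith
  have hLB : B < L * k := by
    have h1 : (|B| + 1) / k ≤ L := by
      have : 0 ≤ C₁ + |M| * r ^ (-s) := by positivity
      linarith
    rw [div_le_iff₀ hk0] at h1
    linarith [le_abs_self B]
  have hLr : |M| ≤ L * r ^ s := by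
    have h1 : |M| * r ^ (-s) ≤ L := by
      have : 0 ≤ C₁ + (|B| + 1) / k := by positivity
      linarith
    rwa [Real.rpow_neg hr.le, ← div_eq_mul_inv, div_le_iff₀ (by positivity)] at h1
  refine ⟨L, hL0, fun u f hsol x₀ hx₀ hM hN x₁ hx₁ y₁ hy₁ => ?_⟩
  have hR16 : R = 16 * r := by rw [hrR]; ring
  have hR8 : R / 2 = 8 * r := by rw [hrR]; ring
  have hR14 : 7 * R / 8 = 14 * r := by rw [hrR]; ring
  have hgrow := hC₁ u f hsol x₀ hx₀ hM hN
  have htail := hT u f hsol x₀ hx₀ hM hN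
  rw [hR14] at hgrow
  rw [hR8] at hx₁
  rw [hR16] at hM hN htail
  by_contra! hcon
  obtain ⟨x, ⟨hxb, hxh⟩, y, ⟨hyb, hyh⟩, hxy, hxyr, huxy, hmax⟩ := exists_doubling_max hs0 hsol hr
    hA0 hL0 hAr hLr hLC (fun x hx => (hM x hx).trans (le_abs_self M)) hgrow hx₁ hcon
  have hest := doubling_estimate hs0 hs1 hsol hr hL0 hxh hyh hxy hxyr (hN x ⟨hxb, hxh⟩)
    (hN y ⟨hyb, hyh⟩) (htail x hxb) huxy hmax
  have e1 : L * (s * (1 - s)) * 4⁻¹ ^ (2 - 2 * s) * directionalMoment d s * r ^ (-s) = L * k := by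
    rw [hk]; ring
  rw [e1] at hest
  linarith

end Doubling

/-! ### Conclusion. -/

/-- The dimension is `n = d + 1`. The constant `C` depends only on `n`, `s`, the size `R` of the
neighbourhood, the bounds `Mu`, `Mf` of `u` and `f` there, and the bound `K` of the norm of `u` in
`L_{2s}`; it does not depend on the boundary point `x₀`. -/
theorem theorem1p2 (d : ℕ) (s : ℝ) (hs0 : 0 < s) (hs1 : s < 1) (hn : 2 * s ≤ ((d + 1 : ℕ) : ℝ))
    (R : ℝ) (hR : 0 < R) (Mu Mf K : ℝ) :
    ∃ C : ℝ, ∀ u f : EuclideanSpace ℝ (Fin (d + 1)) → ℝ,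
      IsNonnegSolution s u f → normL2s s u ≤ K →
      ∀ x₀ : EuclideanSpace ℝ (Fin (d + 1)), x₀ (Fin.last d) = 0 →
        (∀ x ∈ Metric.ball x₀ R ∩ halfSpace d, |u x| ≤ Mu) →
        (∀ x ∈ Metric.ball x₀ R ∩ halfSpace d, |f x| ≤ Mf) →
        (∀ x ∈ Metric.ball x₀ (R / 2) ∩ halfSpace d, u x ≤ C * x (Fin.last d) ^ s) ∧
        (∀ x ∈ Metric.ball x₀ (R / 2) ∩ closure (halfSpace d),
          ∀ y ∈ Metric.ball x₀ (R / 2) ∩ closure (halfSpace d),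
            |u x - u y| ≤ C * ‖x - y‖ ^ s) := by
  -- The lemmas need an upper bound on the whole ball; `max Mu 0` also covers the exterior part,
  -- where `u = 0`.
  obtain ⟨C₁, hC₁0, hC₁⟩ := exists_boundary_growth (d := d) hs0 hs1 hR (max Mu 0) Mf
  obtain ⟨C₂, hC₂0, hC₂⟩ := exists_holder (d := d) hs0 hs1 hR (max Mu 0) Mf
  refine ⟨max C₁ C₂, fun u f hsol _ x₀ hx₀ hMu hMf => ?_⟩
  have hM : ∀ x ∈ Metric.ball x₀ R, u x ≤ max Mu 0 := by
    intro x hx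
    by_cases hxh : x ∈ halfSpace d
    · exact le_max_of_le_left ((le_abs_self _).trans (hMu x ⟨hx, hxh⟩))
    · rw [hsol.exterior x hxh]
      exact le_max_right _ _
  have hholder := hC₂ u f hsol x₀ hx₀ hM hMf
  have hle : ∀ x ∈ Metric.ball x₀ (R / 2), ∀ y ∈ Metric.ball x₀ (R / 2),
      u x - u y ≤ max C₁ C₂ * ‖x - y‖ ^ s := fun x hx y hy =>
    (hholder x hx y hy).trans
      (mul_le_mul_of_nonneg_right (le_max_right _ _) (by positivity))
  refine ⟨fun x hx => ?_, fun x hx y hy => ?_⟩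
  · have hx0 : 0 < x (Fin.last d) := hx.2
    have h := hC₁ u f hsol x₀ hx₀ hM hMf x (Metric.ball_subset_ball (by linarith) hx.1)
    rw [posPow_of_pos hx0] at h
    exact h.trans (mul_le_mul_of_nonneg_right (le_max_left _ _) (by positivity))
  · rw [abs_le]
    have h1 := hle x hx.1 y hy.1
    have h2 := hle y hy.1 x hx.1
    rw [norm_sub_rev] at h2
    constructor <;> linarith
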